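/- Let $n\ge 1$, $\mathbb{T}^n=\mathbb{R}^n/\mathbb{Z}^n$ with fundamental cell $[-\tfrac12,\tfrac12]^n$, and let $\mathcal{D}'(\mathbb{T}^n)$ be the space of (real- or complex-valued) distributions on $\mathbb{T}^n$, i.e. the topological dual of $C^\infty(\mathbb{T}^n)$. Fix a (correspondingly real- or complex-valued) Schwartz function $\Psi\in\mathcal{S}(\mathbb{R}^n)$ with $\int_{\mathbb{R}^n}\Psi\,dx\neq 0$, put $\Psi_\zeta(x)=\zeta^{-n}\Psi(x/\zeta)$ for $\zeta>0$, and for $f\in\mathcal{D}'(\mathbb{T}^n)$ let $$m_\Psi f(x)=\sup_{0<\zeta<\infty}|(f*\Psi_\zeta)(x)|,$$ where $f*\Psi_\zeta$ is the convolution on $\mathbb{R}^n$ of $\Psi_\zeta$ with the periodic extension of $f$; equivalently, $(f*\Psi_\zeta)(x)=\langle f,\Psi_\zeta^{\mathrm{per}}(x-\cdot)\rangle$ with $\Psi_\zeta^{\mathrm{per}}=\sum_{k\in\mathbb{Z}^n}\Psi_\zeta(\cdot+k)$. For $0<p<\infty$ set $$\mathcal{H}^p=\{f\in\mathcal{D}'(\mathbb{T}^n):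 m_\Psi f\in L^p(\mathbb{T}^n)\},\qquad \|f\|_{\mathcal{H}^p}=\|m_\Psi f\|_{L^p(\mathbb{T}^n)}.$$ **Proposition.** Let $0<p\le 1$. Then $\mathcal{H}^p$ is closed under differences, $d(f,g)=\|f-g\|_{\mathcal{H}^p}^p$ is a metric on $\mathcal{H}^p$, and the metric space $(\mathcal{H}^p,d)$ is complete. -/

import Mathlib

open scoped ContDiff SchwartzMap

noncomputable section

namespace TorusHardy

/-- The integer vector `k ∈ ℤⁿ`, seen as a point of `ℝⁿ`. -/
def latticeVec {n : ℕ} (k : Fin n → ℤ) : EuclideanSpace ℝ (Fin n) :=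
  WithLp.toLp 2 (fun i => (k i : ℝ))

/-- The `𝕜`-vector space of smooth `ℤⁿ`-periodic functions `ℝⁿ → 𝕜`. -/
def smoothPeriodic (n : ℕ) (𝕜 : Type*) [RCLike 𝕜] :
    Submodule 𝕜 (EuclideanSpace ℝ (Fin n) → 𝕜) where
  carrier := {φ | ContDiff ℝ ∞ φ ∧ ∀ (k : Fin n → ℤ) x, φ (x + latticeVec k) = φ x}
  add_mem' := by
    rintro φ ψ ⟨h1, h2⟩ ⟨h3, h4⟩
    exact ⟨h1.add h3, fun k x => by simp [h2, h4]⟩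
  zero_mem' := ⟨contDiff_const, fun _ _ => rfl⟩
  smul_mem' := by
    rintro c φ ⟨h1, h2⟩
    exact ⟨contDiff_const.smul h1, fun k x => by simp [h2]⟩

/-- The space `𝒟(𝕋ⁿ) = C^∞(𝕋ⁿ)` of test functions on the torus `𝕋ⁿ = ℝⁿ/ℤⁿ`. Its topology is the
instance below (uniform convergence of all derivatives), not pointwise convergence. -/
def TestFun (n : ℕ) (𝕜 : Type*) [RCLike 𝕜] : Type _ := smoothPeriodic n 𝕜

namespace TestFun

variable {n : ℕ} {𝕜 : Type*} [RCLike 𝕜]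

instance : AddCommGroup (TestFun n 𝕜) := inferInstanceAs (AddCommGroup (smoothPeriodic n 𝕜))

instance : Module 𝕜 (TestFun n 𝕜) := inferInstanceAs (Module 𝕜 (smoothPeriodic n 𝕜))

/-- A test function as a function on `ℝⁿ`. -/
def toFun (φ : TestFun n 𝕜) : EuclideanSpace ℝ (Fin n) → 𝕜 := φ.1

instance : CoeFun (TestFun n 𝕜) (fun _ => EuclideanSpace ℝ (Fin n) → 𝕜) := ⟨toFun⟩

theorem contDiff (φ : TestFun n 𝕜) : ContDiff ℝ ∞ φ := φ.2.1

theorem periodic (φ : TestFun n 𝕜) (k : Fin n → ℤ) (x : EuclideanSpace ℝ (Fin n)) :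
    φ (x + latticeVec k) = φ x := φ.2.2 k x

/-- The derivatives of a test function are bounded. -/
theorem bddAbove_iteratedFDeriv (φ : TestFun n 𝕜) (m : ℕ) :
    BddAbove (Set.range fun x => ‖iteratedFDeriv ℝ m φ x‖) := by
  have hc : Continuous fun x => ‖iteratedFDeriv ℝ m φ x‖ :=
    (φ.contDiff.continuous_iteratedFDeriv (by exact_mod_cast le_top)).norm
  have hper : ∀ (k : Fin n → ℤ) x,
      iteratedFDeriv ℝ m φ (x + latticeVec k) = iteratedFDeriv ℝ m φ x := by
    intro k x
    rw [← iteratedFDeriv_comp_add_right]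
    congr 1
    funext y
    exact φ.periodic k y
  obtain ⟨C, hC⟩ := (isCompact_closedBall (0 : EuclideanSpace ℝ (Fin n))
    (Real.sqrt n)).bddAbove_image hc.continuousOn
  refine ⟨C, ?_⟩
  rintro _ ⟨x, rfl⟩
  have hx := hper (fun i => -⌊x i⌋) x
  show ‖iteratedFDeriv ℝ m φ x‖ ≤ C
  rw [← hx]
  refine hC ⟨_, ?_, rfl⟩
  rw [mem_closedBall_zero_iff, EuclideanSpace.norm_eq]
  refine Real.sqrt_le_sqrt ?_
  calc ∑ i, ‖(x + latticeVec fun i => -⌊x i⌋ : EuclideanSpace ℝ (Fin n)) i‖ ^ 2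
      ≤ ∑ _i : Fin n, (1 : ℝ) := by
        refine Finset.sum_le_sum fun i _ => ?_
        have h0 : (x + latticeVec fun i => -⌊x i⌋ : EuclideanSpace ℝ (Fin n)) i
            = Int.fract (x i) := by
          simp [latticeVec, Int.fract, sub_eq_add_neg]
        rw [h0, Real.norm_eq_abs, abs_of_nonneg (Int.fract_nonneg _)]
        exact pow_le_one₀ (Int.fract_nonneg _) (Int.fract_lt_one _).le
    _ = n := by simp

/-- The seminorm `φ ↦ sup_x ‖D^m φ(x)‖` on test functions. -/
def derivSeminorm (n : ℕ) (𝕜 : Type*) [RCLike 𝕜] (m : ℕ) : Seminorm 𝕜 (TestFun n 𝕜) :=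
  Seminorm.ofSMulLE (fun φ => ⨆ x, ‖iteratedFDeriv ℝ m φ x‖)
    (by
      have h : (fun x => ‖iteratedFDeriv ℝ m (0 : TestFun n 𝕜) x‖) = fun _ => 0 := by
        funext x
        have : ((0 : TestFun n 𝕜) : EuclideanSpace ℝ (Fin n) → 𝕜) = fun _ => 0 := rfl
        rw [this]
        simp
      rw [h]
      exact ciSup_const)
    (by
      intro φ ψ
      refine ciSup_le fun x => ?_
      have h : ((φ + ψ : TestFun n 𝕜) : EuclideanSpace ℝ (Fin n) → 𝕜) =
        (φ : EuclideanSpace ℝ (Fin n) → 𝕜) + ψ := rfl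
      rw [h, iteratedFDeriv_add_apply
        (φ.contDiff.contDiffAt.of_le (by exact_mod_cast le_top))
        (ψ.contDiff.contDiffAt.of_le (by exact_mod_cast le_top))]
      exact (norm_add_le _ _).trans (add_le_add
        (le_ciSup (bddAbove_iteratedFDeriv φ m) x) (le_ciSup (bddAbove_iteratedFDeriv ψ m) x)))
    (by
      intro c φ
      refine ciSup_le fun x => ?_
      have h : ((c • φ : TestFun n 𝕜) : EuclideanSpace ℝ (Fin n) → 𝕜) =
        c • (φ : EuclideanSpace ℝ (Fin n) → 𝕜) := rfl
      rw [h, iteratedFDeriv_const_smul_apply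
        (φ.contDiff.contDiffAt.of_le (by exact_mod_cast le_top)), norm_smul]
      exact mul_le_mul_of_nonneg_left (le_ciSup (bddAbove_iteratedFDeriv φ m) x) (norm_nonneg c))

/-- The usual Fréchet topology of `C^∞(𝕋ⁿ)`, given by the seminorms `sup ‖D^m φ‖`, `m ∈ ℕ`. -/
instance : TopologicalSpace (TestFun n 𝕜) :=
  (SeminormFamily.moduleFilterBasis (𝕜 := 𝕜) (F := TestFun n 𝕜) (derivSeminorm n 𝕜)).topology

theorem withSeminorms : WithSeminorms (𝕜 := 𝕜) (E := TestFun n 𝕜) (derivSeminorm n 𝕜) := ⟨rfl⟩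

/-- The test function `y ↦ φ (x - y)`. -/
def reflect (φ : TestFun n 𝕜) (x : EuclideanSpace ℝ (Fin n)) : TestFun n 𝕜 :=
  ⟨fun y => φ (x - y), φ.contDiff.comp (contDiff_const.sub contDiff_id), fun k y => by
    have h := φ.periodic k (x - (y + latticeVec k))
    have h' : x - (y + latticeVec k) + latticeVec k = x - y := by abel
    rw [h'] at h
    exact h.symm⟩

end TestFun

/-- The space `𝒟'(𝕋ⁿ)` of distributions on the torus: the topological dual of `𝒟(𝕋ⁿ)`. -/
abbrev Distrib (n : ℕ) (𝕜 : Type*) [RCLike 𝕜] : Type _ := TestFun n 𝕜 →L[𝕜] 𝕜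

section Periodization

variable {n : ℕ} {𝕜 : Type*} [RCLike 𝕜]

theorem summable_latticeVec {N : ℕ} (hN : n < N) :
    Summable fun k : Fin n → ℤ => ‖latticeVec k‖⁻¹ ^ N := by
  let b := (EuclideanSpace.basisFun (Fin n) ℝ).toBasis
  let L : Submodule ℤ (EuclideanSpace ℝ (Fin n)) := Submodule.span ℤ (Set.range b)
  have hmem : ∀ k : Fin n → ℤ, latticeVec k ∈ L := by
    intro k
    have h : latticeVec k = ∑ i, k i • b i := by
      ext j
      simp [latticeVec, b, Finset.sum_apply, Pi.single_apply]
    rw [h]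
    exact Submodule.sum_mem _ fun i _ => Submodule.smul_mem _ _ (Submodule.subset_span ⟨i, rfl⟩)
  have hr : Module.finrank ℤ L < N := by
    have h : Module.finrank ℤ L = n := by
      rw [ZLattice.rank ℝ L]
      simp
    omega
  have hs := ZLattice.summable_norm_pow_inv L N hr
  have hinj : Function.Injective fun k : Fin n → ℤ => (⟨latticeVec k, hmem k⟩ : L) := by
    intro k l h
    have h1 : latticeVec k = latticeVec l := congrArg Subtype.val h
    funext i
    have h2 := congrArg (fun v : EuclideanSpace ℝ (Fin n) => v i) h1
    simpa [latticeVec] using h2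
  exact (hs.comp_injective hinj).congr fun k => rfl

/-- The periodization of a Schwartz function is smooth. -/
theorem contDiff_periodization (Ψ : 𝓢(EuclideanSpace ℝ (Fin n), 𝕜)) :
    ContDiff ℝ ∞ fun x => ∑' k : Fin n → ℤ, Ψ (x + latticeVec k) := by
  rw [contDiff_iff_contDiffAt]
  intro x₀
  let χ : ContDiffBump x₀ := ⟨1, 2, one_pos, one_lt_two⟩
  have hχ : ContDiff ℝ ∞ χ := χ.contDiff
  -- decay of the translates, uniformly on bounded sets
  have hdec : ∀ j : ℕ, ∃ C : ℝ, ∀ k : Fin n → ℤ, k ≠ 0 → ∀ x ∈ tsupport χ,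
      ‖iteratedFDeriv ℝ j (fun y => Ψ (y + latticeVec k)) x‖ ≤ C * ‖latticeVec k‖⁻¹ ^ (n + 1) := by
    intro j
    let D := 2 ^ (n + 1) * ((Finset.Iic (n + 1, j)).sup
      fun m => SchwartzMap.seminorm ℝ m.1 m.2) Ψ
    refine ⟨D * (1 + (‖x₀‖ + 2)) ^ (n + 1), fun k hk x hx => ?_⟩
    have hxR : ‖x‖ ≤ ‖x₀‖ + 2 := by
      rw [χ.tsupport_eq] at hx
      have h1 : ‖x - x₀‖ ≤ 2 := mem_closedBall_iff_norm.1 hx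
      have h2 := norm_add_le x₀ (x - x₀)
      rw [add_sub_cancel] at h2
      linarith
    rw [iteratedFDeriv_comp_add_right]
    have hb : (1 + ‖x + latticeVec k‖) ^ (n + 1) *
        ‖iteratedFDeriv ℝ j Ψ (x + latticeVec k)‖ ≤ D :=
      SchwartzMap.one_add_le_sup_seminorm_apply (𝕜 := ℝ) (m := (n + 1, j)) le_rfl le_rfl Ψ _
    have hk0 : 0 < ‖latticeVec k‖ := by
      rw [norm_pos_iff]
      intro h
      apply hk
      funext i
      have h2 := congrArg (fun v : EuclideanSpace ℝ (Fin n) => v i) h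
      simpa [latticeVec] using h2
    have hle : ‖latticeVec k‖ ≤ (1 + (‖x₀‖ + 2)) * (1 + ‖x + latticeVec k‖) := by
      have h1 := norm_sub_le (x + latticeVec k) x
      rw [add_sub_cancel_left] at h1
      nlinarith [norm_nonneg x₀, norm_nonneg (x + latticeVec k)]
    have hle' := pow_le_pow_left₀ hk0.le hle (n + 1)
    rw [mul_pow] at hle'
    rw [inv_pow, ← div_eq_mul_inv, le_div_iff₀ (pow_pos hk0 _)]
    calc _ ≤ ‖iteratedFDeriv ℝ j Ψ (x + latticeVec k)‖ *
          ((1 + (‖x₀‖ + 2)) ^ (n + 1) * (1 + ‖x + latticeVec k‖) ^ (n + 1)) := by gcongr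
      _ = ((1 + ‖x + latticeVec k‖) ^ (n + 1) *
          ‖iteratedFDeriv ℝ j Ψ (x + latticeVec k)‖) * (1 + (‖x₀‖ + 2)) ^ (n + 1) := by ring
      _ ≤ _ := by gcongr
  choose C hC using hdec
  have hbχ : ∀ i : ℕ, ∃ B : ℝ, ∀ x, ‖iteratedFDeriv ℝ i χ x‖ ≤ B := fun i =>
    (hχ.continuous_iteratedFDeriv (by exact_mod_cast le_top)).bounded_above_of_compact_support
      (χ.hasCompactSupport.iteratedFDeriv i)
  choose B hB using hbχ
  have hsm : ContDiff ℝ ∞ fun x => ∑' k : Fin n → ℤ, χ x • Ψ (x + latticeVec k) := by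
    have hΨ : ∀ k : Fin n → ℤ, ContDiff ℝ ∞ fun y => Ψ (y + latticeVec k) := fun k =>
      (Ψ.smooth ⊤).comp (contDiff_id.add contDiff_const)
    refine contDiff_tsum_of_eventually (N := ⊤)
      (v := fun m k => (∑ i ∈ Finset.range (m + 1), (m.choose i : ℝ) * |B i| * |C (m - i)|) *
        ‖latticeVec k‖⁻¹ ^ (n + 1))
      (fun k => hχ.smul (hΨ k)) (fun m _ => (summable_latticeVec (Nat.lt_succ_self n)).mul_left _)
      (fun m _ => ?_)
    have hne : ∀ᶠ k : Fin n → ℤ in Filter.cofinite, k ≠ 0 := by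
      simp [Filter.eventually_cofinite]
    filter_upwards [hne] with k hk x
    refine (norm_iteratedFDeriv_smul_le hχ (hΨ k) x (n := m)
      (by exact_mod_cast le_top)).trans ?_
    rw [Finset.sum_mul]
    refine Finset.sum_le_sum fun i _ => ?_
    by_cases hx : x ∈ tsupport χ
    · have h1 : ‖iteratedFDeriv ℝ i χ x‖ ≤ |B i| := (hB i x).trans (le_abs_self _)
      have h2 : ‖iteratedFDeriv ℝ (m - i) (fun y => Ψ (y + latticeVec k)) x‖ ≤
          |C (m - i)| * ‖latticeVec k‖⁻¹ ^ (n + 1) :=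
        (hC (m - i) k hk x hx).trans (by gcongr; exact le_abs_self _)
      calc _ ≤ (m.choose i : ℝ) * |B i| * (|C (m - i)| * ‖latticeVec k‖⁻¹ ^ (n + 1)) := by gcongr
        _ = _ := by ring
    · have h0 : iteratedFDeriv ℝ i χ x = 0 := by
        by_contra h
        exact hx (support_iteratedFDeriv_subset i h)
      rw [h0]
      simp only [norm_zero, mul_zero, zero_mul]
      positivity
  refine hsm.contDiffAt.congr_of_eventuallyEq ?_
  filter_upwards [χ.eventuallyEq_one] with x hx
  simp only [Pi.one_apply] at hx
  simp [hx]

/-- The periodization `Ψ^per = ∑_{k ∈ ℤⁿ} Ψ(· + k)` of a Schwartz function `Ψ` on `ℝⁿ`. -/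
def periodization (Ψ : 𝓢(EuclideanSpace ℝ (Fin n), 𝕜)) : TestFun n 𝕜 :=
  ⟨fun x => ∑' k : Fin n → ℤ, Ψ (x + latticeVec k), contDiff_periodization Ψ, fun l x => by
    have h : ∀ k : Fin n → ℤ, x + latticeVec l + latticeVec k =
        x + latticeVec (Equiv.addLeft l k) := by
      intro k
      ext i
      simp [latticeVec, add_assoc]
    simp only [h]
    exact (Equiv.addLeft l).tsum_eq fun k : Fin n → ℤ => Ψ (x + latticeVec k)⟩

/-- The dilation `Ψ_ζ(x) = ζ⁻ⁿ Ψ(x / ζ)` of a Schwartz function, for `ζ > 0`. -/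
def dilate (Ψ : 𝓢(EuclideanSpace ℝ (Fin n), 𝕜)) (ζ : Set.Ioi (0 : ℝ)) :
    𝓢(EuclideanSpace ℝ (Fin n), 𝕜) :=
  ((ζ : ℝ) ^ n)⁻¹ • SchwartzMap.compCLMOfContinuousLinearEquiv ℝ
    (ContinuousLinearEquiv.smulLeft (Units.mk0 (ζ : ℝ)⁻¹ (inv_ne_zero ζ.2.ne'))) Ψ

theorem dilate_apply (Ψ : 𝓢(EuclideanSpace ℝ (Fin n), 𝕜)) (ζ : Set.Ioi (0 : ℝ))
    (x : EuclideanSpace ℝ (Fin n)) :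
    dilate Ψ ζ x = ((ζ : ℝ) ^ n)⁻¹ • Ψ ((ζ : ℝ)⁻¹ • x) := rfl

end Periodization

section Hardy

variable {n : ℕ} {𝕜 : Type*} [RCLike 𝕜]

/-- The convolution `f * Ψ` of a distribution `f` on the torus with a Schwartz function `Ψ`
on `ℝⁿ`, that is, of the periodic extension of `f` with `Ψ`: at `x` it is `f` paired with the
test function `y ↦ Ψ^per(x - y)`. -/
def conv (f : Distrib n 𝕜) (Ψ : 𝓢(EuclideanSpace ℝ (Fin n), 𝕜))
    (x : EuclideanSpace ℝ (Fin n)) : 𝕜 :=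
  f ((periodization Ψ).reflect x)

/-- The maximal function `m_Ψ f(x) = sup_{0 < ζ < ∞} |(f * Ψ_ζ)(x)|`, with values in `[0, ∞]`. -/
def maximalFun (Ψ : 𝓢(EuclideanSpace ℝ (Fin n), 𝕜)) (f : Distrib n 𝕜)
    (x : EuclideanSpace ℝ (Fin n)) : ENNReal :=
  ⨆ ζ : Set.Ioi (0 : ℝ), ‖conv f (dilate Ψ ζ) x‖ₑ

/-- Lebesgue measure on the fundamental cell `[-1/2, 1/2]ⁿ` of the torus. -/
def cellMeasure (n : ℕ) : MeasureTheory.Measure (EuclideanSpace ℝ (Fin n)) :=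
  MeasureTheory.volume.restrict {x | ∀ i, x i ∈ Set.Icc (-(1 / 2) : ℝ) (1 / 2)}

/-- The Hardy space `𝓗^p(𝕋ⁿ)`: the distributions `f` with `m_Ψ f ∈ L^p(𝕋ⁿ)`. -/
def hardySpace (Ψ : 𝓢(EuclideanSpace ℝ (Fin n), 𝕜)) (p : ℝ) : Set (Distrib n 𝕜) :=
  {f | MeasureTheory.MemLp (maximalFun Ψ f) (ENNReal.ofReal p) (cellMeasure n)}

/-- The quasinorm `‖f‖_{𝓗^p} = ‖m_Ψ f‖_{L^p(𝕋ⁿ)}` (finite for `f ∈ 𝓗^p`). -/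
def hardyNorm (Ψ : 𝓢(EuclideanSpace ℝ (Fin n), 𝕜)) (p : ℝ) (f : Distrib n 𝕜) : ℝ :=
  (MeasureTheory.eLpNorm (maximalFun Ψ f) (ENNReal.ofReal p) (cellMeasure n)).toReal

end Hardy

end TorusHardy

end

noncomputable section

namespace TorusHardy

open MeasureTheory Metric Filter Topology

/-! ### Smooth dependence of integrals on a parameter. -/

section ParametricIntegral

variable {α : Type*} [MeasurableSpace α] {μ : Measure α}
  {E F : Type*} [NormedAddCommGroup E] [NormedSpace ℝ E] [NormedAddCommGroup F] [NormedSpace ℝ F]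
  {H : α → E → F}

/-! Everything rests on one a priori estimate, `exists_norm_apply_le`: if `∫ |f * Ψ_ζ|^p ≤ A` for
all `ζ`, then `|f φ| ≤ C A^(1/p) ‖φ‖_{C^L}`, where `L` and `C` do not depend on `f`. No comparison
between different maximal functions is needed.

The estimate comes from testing `f` against averages. With `c = ∫ Ψ ≠ 0`, replace `φ` by `c⁻¹ ∫
Ψ_ζ(z) φ(· + z) dz` and repeat on the error at geometrically decreasing scales `ζ = r^j`. This
writes `φ` as a sum of averages of remainders `φ_j`, whose sup norms decay like `2^(-j) r^(jK)` at
the cost of `K + 1` derivatives (`exists_derivSeminorm_remainder_le_half`). By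
`Distrib.map_average`, `f` applied to the average of `φ_j` is `∫ φ_j (f * Ψ_ζ)` over the cell. If
`f` has order `L` with constant `B`, then `|f * Ψ_ζ| ≤ C B ζ^(-n-L)` for `ζ ≤ 1`, and `|u| =
|u|^(1-p) |u|^p` turns the `L^p` hypothesis into an `L^1` bound. Summation over `j` gives order `K +
1` with constant `C B^(1-p) A`, for any `K ≥ (n + L)(1 - p)` (`exists_improved_bound`).

Since `1 - p < 1`, this lowers large orders, so every such `f` has a fixed order `L₀`. At that order
the best constant satisfies `B ≤ C B^(1-p) A`, hence `B ≤ (C A)^(1/p)`.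

The rest is soft. Subadditivity of `t ↦ t^p` gives closure under differences and the triangle
inequality. The estimate makes `d` separate points and makes a Cauchy sequence converge on each test
function to a distribution. Fatou's lemma upgrades this weak limit to a limit in `d`
(`hardyMass_sub_le_of_tendsto`). -/

theorem integrable_iteratedFDeriv_of_dominated
    (hmeas : ∀ m x, AEStronglyMeasurable (fun z => iteratedFDeriv ℝ m (H z) x) μ)
    (hb : ∀ (m : ℕ) (x₀ : E), ∃ b : α → ℝ, Integrable b μ ∧
      ∀ z, ∀ x ∈ ball x₀ 1, ‖iteratedFDeriv ℝ m (H z) x‖ ≤ b z) (m : ℕ) (x : E) :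
    Integrable (fun z => iteratedFDeriv ℝ m (H z) x) μ := by
  obtain ⟨b, hbi, hbd⟩ := hb m x
  exact hbi.mono' (hmeas m x) (ae_of_all _ fun z => hbd z x (mem_ball_self one_pos))

theorem hasFDerivAt_integral_iteratedFDeriv (hH : ∀ z, ContDiff ℝ ∞ (H z))
    (hmeas : ∀ m x, AEStronglyMeasurable (fun z => iteratedFDeriv ℝ m (H z) x) μ)
    (hb : ∀ (m : ℕ) (x₀ : E), ∃ b : α → ℝ, Integrable b μ ∧
      ∀ z, ∀ x ∈ ball x₀ 1, ‖iteratedFDeriv ℝ m (H z) x‖ ≤ b z) (m : ℕ) (x : E) :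
    HasFDerivAt (fun x => ∫ z, iteratedFDeriv ℝ m (H z) x ∂μ)
      (∫ z, fderiv ℝ (iteratedFDeriv ℝ m (H z)) x ∂μ) x := by
  obtain ⟨b, hbi, hbd⟩ := hb (m + 1) x
  refine hasFDerivAt_integral_of_dominated_of_fderiv_le (𝕜 := ℝ) (bound := b)
    (F' := fun x z => fderiv ℝ (iteratedFDeriv ℝ m (H z)) x)
    (ball_mem_nhds x one_pos) (Filter.Eventually.of_forall fun y => hmeas m y)
    (integrable_iteratedFDeriv_of_dominated hmeas hb m x) ?_ ?_ hbi ?_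
  · have h : ∀ z, fderiv ℝ (iteratedFDeriv ℝ m (H z)) x =
        continuousMultilinearCurryLeftEquiv ℝ (fun _ : Fin (m + 1) => E) F
          (iteratedFDeriv ℝ (m + 1) (H z) x) := by
      intro z
      rw [iteratedFDeriv_succ_eq_comp_left]
      simp
    simp only [h]
    exact (LinearIsometryEquiv.continuous _).comp_aestronglyMeasurable (hmeas (m + 1) x)
  · refine ae_of_all _ fun z y hy => ?_
    rw [norm_fderiv_iteratedFDeriv]
    exact hbd z y hy
  · refine ae_of_all _ fun z y _ => ?_
    exact ((hH z).differentiable_iteratedFDeriv (by exact_mod_cast ENat.natCast_lt_top m) y).hasFDerivAt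

/-- The currying isometries identify `D^(m+1)` with the derivative of `D^m`, so the first-order
theorem iterates. An isomorphism passes through the integral without any integrability check.
Lebesgue measure and counting measure on `ℤⁿ` are both used later. -/
theorem iteratedFDeriv_integral (hH : ∀ z, ContDiff ℝ ∞ (H z))
    (hmeas : ∀ m x, AEStronglyMeasurable (fun z => iteratedFDeriv ℝ m (H z) x) μ)
    (hb : ∀ (m : ℕ) (x₀ : E), ∃ b : α → ℝ, Integrable b μ ∧
      ∀ z, ∀ x ∈ ball x₀ 1, ‖iteratedFDeriv ℝ m (H z) x‖ ≤ b z) (m : ℕ) :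
    iteratedFDeriv ℝ m (fun x => ∫ z, H z x ∂μ) =
      fun x => ∫ z, iteratedFDeriv ℝ m (H z) x ∂μ := by
  induction m with
  | zero =>
    funext x
    simp only [iteratedFDeriv_zero_eq_comp, Function.comp_apply]
    exact ((continuousMultilinearCurryFin0 ℝ E F).symm.toContinuousLinearEquiv.integral_comp_comm
      (fun z => H z x)).symm
  | succ m ih =>
    funext x
    simp only [iteratedFDeriv_succ_eq_comp_left, Function.comp_apply, ih]
    rw [(hasFDerivAt_integral_iteratedFDeriv hH hmeas hb m x).fderiv]
    let e : (E →L[ℝ] E [×m]→L[ℝ] F) ≃L[ℝ] (E [×(m + 1)]→L[ℝ] F) :=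
      (continuousMultilinearCurryLeftEquiv ℝ (fun _ : Fin (m + 1) => E)
        F).symm.toContinuousLinearEquiv
    exact (ContinuousLinearEquiv.integral_comp_comm (𝕜 := ℝ) e
      (fun z => fderiv ℝ (iteratedFDeriv ℝ m (H z)) x)).symm

theorem contDiff_integral (hH : ∀ z, ContDiff ℝ ∞ (H z))
    (hmeas : ∀ m x, AEStronglyMeasurable (fun z => iteratedFDeriv ℝ m (H z) x) μ)
    (hb : ∀ (m : ℕ) (x₀ : E), ∃ b : α → ℝ, Integrable b μ ∧
      ∀ z, ∀ x ∈ ball x₀ 1, ‖iteratedFDeriv ℝ m (H z) x‖ ≤ b z) :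
    ContDiff ℝ ∞ (fun x => ∫ z, H z x ∂μ) := by
  refine contDiff_of_differentiable_iteratedFDeriv fun m _ x => ?_
  rw [iteratedFDeriv_integral hH hmeas hb m]
  exact (hasFDerivAt_integral_iteratedFDeriv hH hmeas hb m x).differentiableAt

end ParametricIntegral

/-! ### Translations, reflections and derivative bounds for test functions. -/

namespace TestFun

variable {n : ℕ} {𝕜 : Type*} [RCLike 𝕜]

theorem ext_apply {φ ψ : TestFun n 𝕜} (h : ∀ x, φ x = ψ x) : φ = ψ :=
  Subtype.ext (funext h)

theorem iteratedFDeriv_add (φ ψ : TestFun n 𝕜) (m : ℕ) (x : EuclideanSpace ℝ (Fin n)) :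
    iteratedFDeriv ℝ m (φ + ψ : TestFun n 𝕜) x =
      iteratedFDeriv ℝ m φ x + iteratedFDeriv ℝ m ψ x :=
  iteratedFDeriv_add_apply (f := φ) (g := ψ)
    (φ.contDiff.contDiffAt.of_le (by exact_mod_cast le_top))
    (ψ.contDiff.contDiffAt.of_le (by exact_mod_cast le_top))

theorem iteratedFDeriv_smul (c : 𝕜) (φ : TestFun n 𝕜) (m : ℕ) (x : EuclideanSpace ℝ (Fin n)) :
    iteratedFDeriv ℝ m (c • φ : TestFun n 𝕜) x = c • iteratedFDeriv ℝ m φ x :=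
  iteratedFDeriv_const_smul_apply (f := φ)
    (φ.contDiff.contDiffAt.of_le (by exact_mod_cast le_top))

theorem continuous_iteratedFDeriv (φ : TestFun n 𝕜) (m : ℕ) :
    Continuous fun x => iteratedFDeriv ℝ m φ x :=
  φ.contDiff.continuous_iteratedFDeriv (by exact_mod_cast le_top)

theorem norm_iteratedFDeriv_le (φ : TestFun n 𝕜) (m : ℕ) (x : EuclideanSpace ℝ (Fin n)) :
    ‖iteratedFDeriv ℝ m φ x‖ ≤ derivSeminorm n 𝕜 m φ :=
  le_ciSup (bddAbove_iteratedFDeriv φ m) x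

theorem derivSeminorm_le {φ : TestFun n 𝕜} {m : ℕ} {C : ℝ}
    (h : ∀ x, ‖iteratedFDeriv ℝ m φ x‖ ≤ C) : derivSeminorm n 𝕜 m φ ≤ C :=
  ciSup_le h

theorem norm_apply_le (φ : TestFun n 𝕜) (x : EuclideanSpace ℝ (Fin n)) :
    ‖φ x‖ ≤ derivSeminorm n 𝕜 0 φ := by
  simpa using norm_iteratedFDeriv_le φ 0 x

theorem norm_iteratedFDeriv_sub_le (φ : TestFun n 𝕜) (m : ℕ) (x y : EuclideanSpace ℝ (Fin n)) :
    ‖iteratedFDeriv ℝ m φ x - iteratedFDeriv ℝ m φ y‖ ≤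
      derivSeminorm n 𝕜 (m + 1) φ * ‖x - y‖ := by
  refine convex_univ.norm_image_sub_le_of_norm_fderiv_le (𝕜 := ℝ) (fun z _ => ?_) (fun z _ => ?_)
    (Set.mem_univ y) (Set.mem_univ x)
  · exact φ.contDiff.differentiable_iteratedFDeriv (by exact_mod_cast ENat.natCast_lt_top m) z
  · rw [norm_fderiv_iteratedFDeriv]
    exact norm_iteratedFDeriv_le φ (m + 1) z

/-- The translate `y ↦ φ (y + a)` of a test function. -/
def shift (φ : TestFun n 𝕜) (a : EuclideanSpace ℝ (Fin n)) : TestFun n 𝕜 :=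
  ⟨fun y => φ (y + a), φ.contDiff.comp (contDiff_id.add contDiff_const), fun k y => by
    change φ (y + latticeVec k + a) = φ (y + a)
    rw [add_right_comm]
    exact φ.periodic k _⟩

theorem iteratedFDeriv_shift (φ : TestFun n 𝕜) (a : EuclideanSpace ℝ (Fin n)) (m : ℕ)
    (x : EuclideanSpace ℝ (Fin n)) :
    iteratedFDeriv ℝ m (φ.shift a) x = iteratedFDeriv ℝ m φ (x + a) :=
  iteratedFDeriv_comp_add_right (f := φ) m a x

theorem reflect_eq_shift (φ : TestFun n 𝕜) (x : EuclideanSpace ℝ (Fin n)) :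
    φ.reflect x = (φ.reflect 0).shift (-x) :=
  ext_apply fun y => by
    change φ (x - y) = φ (0 - (y + -x))
    congr 1
    abel

theorem derivSeminorm_reflect_le (φ : TestFun n 𝕜) (x : EuclideanSpace ℝ (Fin n)) (m : ℕ) :
    derivSeminorm n 𝕜 m (φ.reflect x) ≤ derivSeminorm n 𝕜 m φ := by
  refine derivSeminorm_le fun y => ?_
  have h : ((φ.reflect x : TestFun n 𝕜) : EuclideanSpace ℝ (Fin n) → 𝕜) =
      fun y => φ (x - y) := rfl
  have h' : (fun y => φ (x - y)) = (φ.shift x : EuclideanSpace ℝ (Fin n) → 𝕜) ∘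
      LinearIsometryEquiv.neg ℝ := by
    funext y
    change φ (x - y) = φ (-y + x)
    congr 1
    abel
  rw [h, h', LinearIsometryEquiv.norm_iteratedFDeriv_comp_right, iteratedFDeriv_shift]
  exact norm_iteratedFDeriv_le φ m _

/-! ### Integral superpositions of translates. -/

section Superposition

theorem iteratedFDeriv_smul_shift (φ : TestFun n 𝕜) (m : ℕ) (x : EuclideanSpace ℝ (Fin n))
    (c : 𝕜) (b : EuclideanSpace ℝ (Fin n)) :
    iteratedFDeriv ℝ m (fun y => c * φ (y + b)) x = c • iteratedFDeriv ℝ m φ (x + b) := by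
  rw [← iteratedFDeriv_shift, ← iteratedFDeriv_smul]
  rfl

variable {α : Type*} [MeasurableSpace α] {μ : Measure α} {w : α → 𝕜}
  {a : α → EuclideanSpace ℝ (Fin n)}

theorem aestronglyMeasurable_smul_shift (φ : TestFun n 𝕜) (hw : Integrable w μ)
    (ha : AEStronglyMeasurable a μ) (m : ℕ) (x : EuclideanSpace ℝ (Fin n)) :
    AEStronglyMeasurable (fun z => iteratedFDeriv ℝ m (fun y => w z * φ (y + a z)) x) μ := by
  simp only [iteratedFDeriv_smul_shift]
  exact hw.1.smul ((φ.continuous_iteratedFDeriv m).comp_aestronglyMeasurable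
    (aestronglyMeasurable_const.add ha))

theorem dominated_smul_shift (φ : TestFun n 𝕜) (hw : Integrable w μ) (m : ℕ)
    (x₀ : EuclideanSpace ℝ (Fin n)) : ∃ b : α → ℝ, Integrable b μ ∧ ∀ z, ∀ x ∈ ball x₀ 1,
      ‖iteratedFDeriv ℝ m (fun y => w z * φ (y + a z)) x‖ ≤ b z := by
  refine ⟨fun z => ‖w z‖ * derivSeminorm n 𝕜 m φ, hw.norm.mul_const _, fun z x _ => ?_⟩
  rw [iteratedFDeriv_smul_shift, norm_smul]
  exact mul_le_mul_of_nonneg_left (norm_iteratedFDeriv_le φ m _) (norm_nonneg _)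

/-- The superposition `y ↦ ∫ w(z) φ(y + a(z)) dμ(z)` of translates of a test function. -/
def superpose (φ : TestFun n 𝕜) (hw : Integrable w μ) (ha : AEStronglyMeasurable a μ) :
    TestFun n 𝕜 :=
  ⟨fun y => ∫ z, w z * φ (y + a z) ∂μ,
    contDiff_integral (fun z => contDiff_const.mul (φ.shift (a z)).contDiff)
      (aestronglyMeasurable_smul_shift φ hw ha) (dominated_smul_shift φ hw),
    fun k y => by
      change ∫ z, w z * φ (y + latticeVec k + a z) ∂μ = ∫ z, w z * φ (y + a z) ∂μ
      simp only [add_right_comm y, φ.periodic]⟩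

theorem superpose_apply (φ : TestFun n 𝕜) (hw : Integrable w μ) (ha : AEStronglyMeasurable a μ)
    (y : EuclideanSpace ℝ (Fin n)) : φ.superpose hw ha y = ∫ z, w z * φ (y + a z) ∂μ := rfl

theorem iteratedFDeriv_superpose (φ : TestFun n 𝕜) (hw : Integrable w μ)
    (ha : AEStronglyMeasurable a μ) (m : ℕ) (x : EuclideanSpace ℝ (Fin n)) :
    iteratedFDeriv ℝ m (φ.superpose hw ha) x =
      ∫ z, w z • iteratedFDeriv ℝ m φ (x + a z) ∂μ := by
  have h := congrFun (iteratedFDeriv_integral (H := fun z y => w z * φ (y + a z))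
    (fun z => contDiff_const.mul (φ.shift (a z)).contDiff)
    (aestronglyMeasurable_smul_shift φ hw ha) (dominated_smul_shift φ hw) m) x
  simp only [iteratedFDeriv_smul_shift] at h
  exact h

theorem derivSeminorm_superpose_le (φ : TestFun n 𝕜) (hw : Integrable w μ)
    (ha : AEStronglyMeasurable a μ) (m : ℕ) :
    derivSeminorm n 𝕜 m (φ.superpose hw ha) ≤ (∫ z, ‖w z‖ ∂μ) * derivSeminorm n 𝕜 m φ := by
  refine derivSeminorm_le fun x => ?_
  rw [iteratedFDeriv_superpose, ← integral_mul_const]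
  refine norm_integral_le_of_norm_le (hw.norm.mul_const _) (ae_of_all _ fun z => ?_)
  rw [norm_smul]
  exact mul_le_mul_of_nonneg_left (norm_iteratedFDeriv_le φ m _) (norm_nonneg _)

end Superposition

/-! ### Finite-order norms and the embedding of test functions into a Banach space of jets. -/

/-- The seminorm `φ ↦ max_{m ≤ L} sup_x ‖D^m φ(x)‖`. -/
def orderSeminorm (n : ℕ) (𝕜 : Type*) [RCLike 𝕜] (L : ℕ) : Seminorm 𝕜 (TestFun n 𝕜) :=
  (Finset.range (L + 1)).sup (derivSeminorm n 𝕜)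

theorem derivSeminorm_le_orderSeminorm {m L : ℕ} (h : m ≤ L) (φ : TestFun n 𝕜) :
    derivSeminorm n 𝕜 m φ ≤ orderSeminorm n 𝕜 L φ :=
  Seminorm.le_finset_sup_apply (Finset.mem_range.2 (Nat.lt_succ_of_le h))

theorem orderSeminorm_le {L : ℕ} {φ : TestFun n 𝕜} {C : ℝ} (hC : 0 ≤ C)
    (h : ∀ m ≤ L, derivSeminorm n 𝕜 m φ ≤ C) : orderSeminorm n 𝕜 L φ ≤ C :=
  Seminorm.finset_sup_apply_le hC fun m hm => h m (Nat.lt_succ_iff.1 (Finset.mem_range.1 hm))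

theorem orderSeminorm_mono {K L : ℕ} (h : K ≤ L) (φ : TestFun n 𝕜) :
    orderSeminorm n 𝕜 K φ ≤ orderSeminorm n 𝕜 L φ :=
  orderSeminorm_le (apply_nonneg _ _) fun _ hm => derivSeminorm_le_orderSeminorm (hm.trans h) φ

/-- The target of the jet map: bounded continuous derivatives of order at most `L`. -/
def JetSpace (n : ℕ) (𝕜 : Type*) [RCLike 𝕜] (L : ℕ) : Type _ :=
  (i : Fin (L + 1)) → BoundedContinuousFunction (EuclideanSpace ℝ (Fin n))
    (EuclideanSpace ℝ (Fin n) [×(i : ℕ)]→L[ℝ] 𝕜)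

instance (L : ℕ) : NormedAddCommGroup (JetSpace n 𝕜 L) :=
  inferInstanceAs (NormedAddCommGroup ((i : Fin (L + 1)) → BoundedContinuousFunction
    (EuclideanSpace ℝ (Fin n)) (EuclideanSpace ℝ (Fin n) [×(i : ℕ)]→L[ℝ] 𝕜)))

instance (L : ℕ) : NormedSpace 𝕜 (JetSpace n 𝕜 L) :=
  inferInstanceAs (NormedSpace 𝕜 ((i : Fin (L + 1)) → BoundedContinuousFunction
    (EuclideanSpace ℝ (Fin n)) (EuclideanSpace ℝ (Fin n) [×(i : ℕ)]→L[ℝ] 𝕜)))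

instance (L : ℕ) : NormedSpace ℝ (JetSpace n 𝕜 L) :=
  inferInstanceAs (NormedSpace ℝ ((i : Fin (L + 1)) → BoundedContinuousFunction
    (EuclideanSpace ℝ (Fin n)) (EuclideanSpace ℝ (Fin n) [×(i : ℕ)]→L[ℝ] 𝕜)))

instance (L : ℕ) : CompleteSpace (JetSpace n 𝕜 L) :=
  inferInstanceAs (CompleteSpace ((i : Fin (L + 1)) → BoundedContinuousFunction
    (EuclideanSpace ℝ (Fin n)) (EuclideanSpace ℝ (Fin n) [×(i : ℕ)]→L[ℝ] 𝕜)))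

theorem JetSpace.norm_apply_le {L : ℕ} (J : JetSpace n 𝕜 L) (i : Fin (L + 1))
    (x : EuclideanSpace ℝ (Fin n)) : ‖J i x‖ ≤ ‖J‖ :=
  ((J i).norm_coe_le_norm x).trans (norm_le_pi_norm (G := fun i : Fin (L + 1) =>
    BoundedContinuousFunction (EuclideanSpace ℝ (Fin n))
      (EuclideanSpace ℝ (Fin n) [×(i : ℕ)]→L[ℝ] 𝕜)) J i)

theorem JetSpace.norm_le {L : ℕ} {J : JetSpace n 𝕜 L} {C : ℝ} (hC : 0 ≤ C)
    (h : ∀ i x, ‖J i x‖ ≤ C) : ‖J‖ ≤ C :=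
  (pi_norm_le_iff_of_nonneg (G := fun i : Fin (L + 1) =>
    BoundedContinuousFunction (EuclideanSpace ℝ (Fin n))
      (EuclideanSpace ℝ (Fin n) [×(i : ℕ)]→L[ℝ] 𝕜)) hC).2 fun i =>
    (BoundedContinuousFunction.norm_le hC).2 (h i)

/-- Evaluation of the component of order `i` of a jet at a point. -/
def JetSpace.eval {L : ℕ} (i : Fin (L + 1)) (x : EuclideanSpace ℝ (Fin n)) :
    JetSpace n 𝕜 L →L[𝕜] (EuclideanSpace ℝ (Fin n) [×(i : ℕ)]→L[ℝ] 𝕜) :=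
  LinearMap.mkContinuous
    { toFun := fun J => J i x
      map_add' := fun _ _ => rfl
      map_smul' := fun _ _ => rfl } 1 fun J => by
      rw [one_mul]
      exact J.norm_apply_le i x

/-- The jet map `φ ↦ (φ, Dφ, …, D^L φ)`. -/
def jet (n : ℕ) (𝕜 : Type*) [RCLike 𝕜] (L : ℕ) : TestFun n 𝕜 →ₗ[𝕜] JetSpace n 𝕜 L where
  toFun φ i := BoundedContinuousFunction.ofNormedAddCommGroup _
    (φ.continuous_iteratedFDeriv i) _ (φ.norm_iteratedFDeriv_le i)
  map_add' φ ψ := by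
    funext i
    ext1 x
    exact iteratedFDeriv_add φ ψ i x
  map_smul' c φ := by
    funext i
    ext1 x
    exact iteratedFDeriv_smul c φ i x

theorem jet_apply (L : ℕ) (φ : TestFun n 𝕜) (i : Fin (L + 1)) (x : EuclideanSpace ℝ (Fin n)) :
    jet n 𝕜 L φ i x = iteratedFDeriv ℝ i φ x := rfl

theorem orderSeminorm_le_norm_jet (L : ℕ) (φ : TestFun n 𝕜) :
    orderSeminorm n 𝕜 L φ ≤ ‖jet n 𝕜 L φ‖ := by
  exact orderSeminorm_le (norm_nonneg _) fun m hm => derivSeminorm_le fun x =>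
    (jet n 𝕜 L φ).norm_apply_le ⟨m, Nat.lt_succ_of_le hm⟩ x

theorem jet_injective (L : ℕ) : Function.Injective (jet n 𝕜 L) := by
  refine (injective_iff_map_eq_zero (jet n 𝕜 L)).2 fun φ h => ?_
  refine ext_apply fun x => ?_
  have h1 := orderSeminorm_le_norm_jet L φ
  rw [h, norm_zero] at h1
  have h2 := (norm_apply_le φ x).trans
    ((derivSeminorm_le_orderSeminorm (Nat.zero_le L) φ).trans h1)
  exact norm_le_zero_iff.1 h2

/-- By the mean value inequality, translation is Lipschitz into jets of order `L`, with constant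
controlled by one further derivative. This supplies the measurability needed for Bochner integrals
of translates. -/
theorem continuous_jet_shift (L : ℕ) (φ : TestFun n 𝕜) :
    Continuous fun a => jet n 𝕜 L (φ.shift a) := by
  have hL : LipschitzWith (Real.toNNReal (orderSeminorm n 𝕜 (L + 1) φ))
      fun a => jet n 𝕜 L (φ.shift a) := by
    refine LipschitzWith.of_dist_le_mul fun a b => ?_
    rw [Real.coe_toNNReal _ (apply_nonneg _ _), dist_eq_norm, dist_eq_norm, ← map_sub]
    refine JetSpace.norm_le (by positivity) fun i x => ?_
    have h : jet n 𝕜 L (φ.shift a - φ.shift b) i x =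
        iteratedFDeriv ℝ i φ (x + a) - iteratedFDeriv ℝ i φ (x + b) := by
      rw [← iteratedFDeriv_shift, ← iteratedFDeriv_shift, map_sub]
      rfl
    rw [h]
    refine (norm_iteratedFDeriv_sub_le φ i (x + a) (x + b)).trans ?_
    rw [add_sub_add_left_eq_sub]
    gcongr
    exact derivSeminorm_le_orderSeminorm (by omega) φ
  exact hL.continuous

/-- A linear functional of finite order factors through a continuous functional of jets. -/
theorem exists_jet_factor {f : TestFun n 𝕜 →ₗ[𝕜] 𝕜} {L : ℕ} {B : ℝ}
    (h : ∀ φ, ‖f φ‖ ≤ B * orderSeminorm n 𝕜 L φ) :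
    ∃ g : JetSpace n 𝕜 L →L[𝕜] 𝕜, ∀ φ, f φ = g (jet n 𝕜 L φ) := by
  let e := LinearEquiv.ofInjective (jet n 𝕜 L) (jet_injective L)
  let f₁ : LinearMap.range (jet n 𝕜 L) →L[𝕜] 𝕜 :=
    LinearMap.mkContinuous (f ∘ₗ e.symm.toLinearMap) |B| (by
      intro ψ
      obtain ⟨φ, rfl⟩ := e.surjective ψ
      have h1 : f (e.symm (e φ)) = f φ := by simp
      change ‖f (e.symm (e φ))‖ ≤ _
      rw [h1]
      have h2 : ‖e φ‖ = ‖jet n 𝕜 L φ‖ := rfl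
      rw [h2]
      calc ‖f φ‖ ≤ B * orderSeminorm n 𝕜 L φ := h φ
        _ ≤ |B| * orderSeminorm n 𝕜 L φ := by
          gcongr
          exact le_abs_self B
        _ ≤ _ := by
          gcongr
          exact orderSeminorm_le_norm_jet L φ)
  obtain ⟨g, hg, -⟩ := exists_extension_norm_eq (𝕜 := 𝕜) (LinearMap.range (jet n 𝕜 L)) f₁
  refine ⟨g, fun φ => ?_⟩
  have h1 := hg (e φ)
  have h2 : f₁ (e φ) = f φ := by
    change f (e.symm (e φ)) = f φ
    simp
  rw [← h2, ← h1]
  rfl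

end TestFun

/-! ### Finite order of distributions and their action on superpositions. -/

open TestFun

theorem Distrib.exists_order {n : ℕ} {𝕜 : Type*} [RCLike 𝕜] (f : Distrib n 𝕜) :
    ∃ (L : ℕ) (B : ℝ), 0 ≤ B ∧ ∀ φ, ‖f φ‖ ≤ B * orderSeminorm n 𝕜 L φ := by
  obtain ⟨s, C, -, hC⟩ := Seminorm.bound_of_continuous (withSeminorms (n := n) (𝕜 := 𝕜))
    ((normSeminorm 𝕜 𝕜).comp f.toLinearMap) (continuous_norm.comp f.continuous)
  refine ⟨s.sup id, C, C.2, fun φ => (hC φ).trans ?_⟩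
  change (C : ℝ) * _ ≤ _
  gcongr
  exact Seminorm.finset_sup_apply_le (apply_nonneg _ _) fun i hi =>
    derivSeminorm_le_orderSeminorm (Finset.le_sup (f := id) hi) φ

/-- The test functions form only a Fréchet space, so the integral is taken in the Banach space of
jets, to which `f` extends by Hahn–Banach. There a continuous functional commutes with the Bochner
integral. -/
theorem Distrib.map_superpose {n : ℕ} {𝕜 : Type*} [RCLike 𝕜] (f : Distrib n 𝕜)
    {α : Type*} [MeasurableSpace α] {μ : Measure α} {w : α → 𝕜}
    {a : α → EuclideanSpace ℝ (Fin n)} (φ : TestFun n 𝕜) (hw : Integrable w μ)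
    (ha : AEStronglyMeasurable a μ) :
    f (φ.superpose hw ha) = ∫ z, w z * f (φ.shift (a z)) ∂μ := by
  obtain ⟨L, B, -, hB⟩ := f.exists_order
  obtain ⟨g, hg⟩ := exists_jet_factor (f := f.toLinearMap) hB
  replace hg : ∀ φ, f φ = g (jet n 𝕜 L φ) := hg
  have hbd : ∀ z, ‖jet n 𝕜 L (φ.shift (a z))‖ ≤ orderSeminorm n 𝕜 L φ := by
    intro z
    refine JetSpace.norm_le (apply_nonneg _ _) fun i x => ?_
    rw [jet_apply, iteratedFDeriv_shift]
    exact (norm_iteratedFDeriv_le φ i _).trans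
      (derivSeminorm_le_orderSeminorm (Nat.lt_succ_iff.1 i.2) φ)
  have hint : Integrable (fun z => w z • jet n 𝕜 L (φ.shift (a z))) μ := by
    refine (hw.norm.mul_const (orderSeminorm n 𝕜 L φ)).mono'
      (hw.1.smul ((continuous_jet_shift L φ).comp_aestronglyMeasurable ha))
      (ae_of_all _ fun z => ?_)
    rw [norm_smul]
    gcongr
    exact hbd z
  have hjet : jet n 𝕜 L (φ.superpose hw ha) = ∫ z, w z • jet n 𝕜 L (φ.shift (a z)) ∂μ := by
    funext i
    ext1 x
    rw [jet_apply, iteratedFDeriv_superpose]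
    have h := (JetSpace.eval i x).integral_comp_comm hint
    refine Eq.trans ?_ h
    refine integral_congr_ae (ae_of_all _ fun z => ?_)
    change _ = w z • jet n 𝕜 L (φ.shift (a z)) i x
    rw [jet_apply, iteratedFDeriv_shift]
  rw [hg, hjet, ← g.integral_comp_comm hint]
  refine integral_congr_ae (ae_of_all _ fun z => ?_)
  simp [hg]

/-! ### Tiling of `ℝⁿ` by unit cells and unfolding of integrals. -/

section Cell

variable {n : ℕ}

/-- The half-open unit cell centred at the lattice point `k`. -/
def halfOpenCell (k : Fin n → ℤ) : Set (EuclideanSpace ℝ (Fin n)) :=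
  {x | ∀ i, x i - k i ∈ Set.Ico (-(1 / 2) : ℝ) (1 / 2)}

theorem measurableSet_halfOpenCell (k : Fin n → ℤ) : MeasurableSet (halfOpenCell k) := by
  have h : halfOpenCell k = ⋂ i, (fun x : EuclideanSpace ℝ (Fin n) => x i - k i) ⁻¹'
      Set.Ico (-(1 / 2) : ℝ) (1 / 2) := by
    ext x
    simp [halfOpenCell]
  rw [h]
  refine MeasurableSet.iInter fun i => measurableSet_preimage ?_ measurableSet_Ico
  exact Continuous.measurable (by fun_prop)

theorem pairwise_disjoint_halfOpenCell :
    Pairwise (Function.onFun Disjoint (halfOpenCell (n := n))) := by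
  intro k l hkl
  rw [Function.onFun, Set.disjoint_left]
  intro x hk hl
  apply hkl
  funext i
  have h1 := hk i
  have h2 := hl i
  rw [Set.mem_Ico] at h1 h2
  have h3 : ((k i : ℝ)) < l i + 1 := by linarith
  have h4 : ((l i : ℝ)) < k i + 1 := by linarith
  have h5 : k i < l i + 1 := by exact_mod_cast h3
  have h6 : l i < k i + 1 := by exact_mod_cast h4
  omega

theorem iUnion_halfOpenCell : ⋃ k : Fin n → ℤ, halfOpenCell k = Set.univ := by
  refine Set.eq_univ_of_forall fun x => Set.mem_iUnion.2 ⟨fun i => ⌊x i + 1 / 2⌋, fun i => ?_⟩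
  have h1 := Int.floor_le (x i + 1 / 2)
  have h2 := Int.lt_floor_add_one (x i + 1 / 2)
  constructor <;> linarith

theorem cell_eq_preimage : {x : EuclideanSpace ℝ (Fin n) |
    ∀ i, x i ∈ Set.Icc (-(1 / 2) : ℝ) (1 / 2)} =
      WithLp.ofLp ⁻¹' Set.Icc (fun _ : Fin n => (-(1 / 2) : ℝ)) (fun _ => 1 / 2) := by
  ext x
  simp [Pi.le_def, forall_and]

/-- The closed cell overlaps its translates on its boundary, which is null. The half-open cells tile
exactly. -/
theorem cellMeasure_eq_restrict_halfOpenCell :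
    cellMeasure n = volume.restrict (halfOpenCell (0 : Fin n → ℤ)) := by
  have h := (PiLp.volume_preserving_ofLp (Fin n)).quasiMeasurePreserving.preimage_ae_eq
    (Measure.univ_pi_Ico_ae_eq_Icc (μ := fun _ : Fin n => (volume : Measure ℝ))
      (f := fun _ => -(1 / 2)) (g := fun _ => 1 / 2))
  rw [cellMeasure, cell_eq_preimage, ← Measure.restrict_congr_set h]
  congr 1
  ext x
  simp [halfOpenCell]

instance : IsFiniteMeasure (cellMeasure n) := by
  refine ⟨?_⟩
  rw [cellMeasure, Measure.restrict_apply_univ, cell_eq_preimage,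
    (PiLp.volume_preserving_ofLp (Fin n)).measure_preimage measurableSet_Icc.nullMeasurableSet]
  exact isCompact_Icc.measure_lt_top

theorem hasSum_integral_cell {F : Type*} [NormedAddCommGroup F] [NormedSpace ℝ F]
    {h : EuclideanSpace ℝ (Fin n) → F} (hh : Integrable h) :
    HasSum (fun k : Fin n → ℤ => ∫ x, h (x + latticeVec k) ∂cellMeasure n) (∫ x, h x) := by
  have h1 := hasSum_integral_iUnion (μ := volume) (f := h) measurableSet_halfOpenCell
    (pairwise_disjoint_halfOpenCell (n := n)) hh.integrableOn
  rw [iUnion_halfOpenCell, Measure.restrict_univ] at h1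
  convert h1 using 2 with k
  rw [cellMeasure_eq_restrict_halfOpenCell,
    ← (measurePreserving_add_right volume (latticeVec k)).setIntegral_preimage_emb
      (measurableEmbedding_addRight (latticeVec k)) h (halfOpenCell k)]
  congr 2
  ext x
  change (∀ i, x i - ((0 : Fin n → ℤ) i : ℝ) ∈ _) ↔ ∀ i, x i + (k i : ℝ) - k i ∈ _
  simp only [Pi.zero_apply, Int.cast_zero, sub_zero, add_sub_cancel_right]

theorem integrable_comp_add_cell {F : Type*} [NormedAddCommGroup F]
    {h : EuclideanSpace ℝ (Fin n) → F} (hh : Integrable h) (a : EuclideanSpace ℝ (Fin n)) :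
    Integrable (fun x => h (x + a)) (cellMeasure n) :=
  (hh.comp_add_right a).integrableOn

theorem integral_cell_tsum {F : Type*} [NormedAddCommGroup F] [NormedSpace ℝ F]
    {h : EuclideanSpace ℝ (Fin n) → F} (hh : Integrable h) :
    ∫ x, ∑' k : Fin n → ℤ, h (x + latticeVec k) ∂cellMeasure n = ∫ x, h x := by
  have hs := hasSum_integral_of_summable_integral_norm (μ := cellMeasure n)
    (F := fun (k : Fin n → ℤ) x => h (x + latticeVec k))
    (fun k => integrable_comp_add_cell hh (latticeVec k)) (hasSum_integral_cell hh.norm).summable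
  exact hs.unique (hasSum_integral_cell hh)

end Cell

/-! ### Convolutions of distributions: duality with averages, continuity, measurability. -/

section Conv

variable {n : ℕ} {𝕜 : Type*} [RCLike 𝕜]

theorem TestFun.continuous (φ : TestFun n 𝕜) : Continuous φ := φ.contDiff.continuous

theorem TestFun.integrable_cell (φ : TestFun n 𝕜) : Integrable φ (cellMeasure n) :=
  (integrable_const (derivSeminorm n 𝕜 0 φ)).mono' φ.continuous.aestronglyMeasurable
    (ae_of_all _ φ.norm_apply_le)

/-- Unfolding: periodicity moves `φ` inside the lattice sum, and the cell integral of that sum is an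
integral over `ℝⁿ`. -/
theorem integral_cell_mul_periodization (Ψ : 𝓢(EuclideanSpace ℝ (Fin n), 𝕜)) (φ : TestFun n 𝕜)
    (y : EuclideanSpace ℝ (Fin n)) :
    ∫ x, φ x * periodization Ψ (x - y) ∂cellMeasure n = ∫ z, Ψ z * φ (y + z) := by
  have hΨ : Integrable fun x => Ψ (x - y) := Ψ.integrable.comp_sub_right y
  have hint : Integrable fun x => φ x * Ψ (x - y) := by
    refine (hΨ.norm.const_mul (derivSeminorm n 𝕜 0 φ)).mono'
      (φ.continuous.aestronglyMeasurable.mul hΨ.1) (ae_of_all _ fun x => ?_)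
    rw [norm_mul]
    exact mul_le_mul_of_nonneg_right (φ.norm_apply_le x) (norm_nonneg _)
  have hper : ∀ x, periodization Ψ (x - y) =
      ∑' k : Fin n → ℤ, Ψ (x + latticeVec k - y) := by
    intro x
    change ∑' k : Fin n → ℤ, Ψ (x - y + latticeVec k) = _
    simp only [sub_add_eq_add_sub]
  have e1 : (fun x => φ x * periodization Ψ (x - y)) =
      fun x => ∑' k : Fin n → ℤ, φ (x + latticeVec k) * Ψ (x + latticeVec k - y) := by
    funext x
    simp_rw [φ.periodic, tsum_mul_left, hper x]
  have e2 : (fun z => Ψ z * φ (y + z)) = fun z => φ (z + y) * Ψ (z + y - y) := by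
    funext z
    rw [add_sub_cancel_right, mul_comm, add_comm]
  rw [e1, e2, integral_cell_tsum hint, integral_add_right_eq_self (μ := volume) (fun x => φ x * Ψ (x - y)) y]

/-- The average `y ↦ ∫ Ψ(z) φ(y + z) dz` of translates of a test function. -/
def average (Ψ : 𝓢(EuclideanSpace ℝ (Fin n), 𝕜)) (φ : TestFun n 𝕜) : TestFun n 𝕜 :=
  φ.superpose (μ := volume) (a := id) Ψ.integrable aestronglyMeasurable_id

theorem average_apply (Ψ : 𝓢(EuclideanSpace ℝ (Fin n), 𝕜)) (φ : TestFun n 𝕜)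
    (y : EuclideanSpace ℝ (Fin n)) : average Ψ φ y = ∫ z, Ψ z * φ (y + z) := rfl

theorem conv_eq_shift (f : Distrib n 𝕜) (Ψ : 𝓢(EuclideanSpace ℝ (Fin n), 𝕜))
    (x : EuclideanSpace ℝ (Fin n)) :
    conv f Ψ x = f (((periodization Ψ).reflect 0).shift (-x)) := by
  rw [conv, reflect_eq_shift]

/-- Unfolding shows that averaging `φ` against `Ψ` superposes, with weight `φ(x)` on the cell, the
functions `y ↦ Ψ^per(x - y)`. Applying `f` under the integral leaves `f * Ψ`. This is the link
between arbitrary test functions and the maximal function. -/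
theorem Distrib.map_average (f : Distrib n 𝕜) (Ψ : 𝓢(EuclideanSpace ℝ (Fin n), 𝕜))
    (φ : TestFun n 𝕜) : f (average Ψ φ) = ∫ x, φ x * conv f Ψ x ∂cellMeasure n := by
  have hm : AEStronglyMeasurable (fun x : EuclideanSpace ℝ (Fin n) => -x) (cellMeasure n) :=
    continuous_neg.aestronglyMeasurable
  have h : average Ψ φ = ((periodization Ψ).reflect 0).superpose φ.integrable_cell hm := by
    refine ext_apply fun y => ?_
    rw [average_apply, superpose_apply, ← integral_cell_mul_periodization]
    congr 1
    funext x
    change _ = φ x * periodization Ψ (0 - (y + -x))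
    congr 2
    abel
  rw [h, f.map_superpose]
  simp only [conv_eq_shift]

theorem continuous_conv (f : Distrib n 𝕜) (Ψ : 𝓢(EuclideanSpace ℝ (Fin n), 𝕜)) :
    Continuous (conv f Ψ) := by
  obtain ⟨L, B, -, hB⟩ := f.exists_order
  obtain ⟨g, hg⟩ := exists_jet_factor (f := f.toLinearMap) hB
  have h : conv f Ψ =
      fun x => g (jet n 𝕜 L (((periodization Ψ).reflect 0).shift (-x))) := by
    funext x
    rw [conv_eq_shift]
    exact hg _
  rw [h]
  exact g.continuous.comp ((continuous_jet_shift L _).comp continuous_neg)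

/-- The supremum is uncountable, so measurability goes through lower semicontinuity. -/
theorem measurable_maximalFun (Ψ : 𝓢(EuclideanSpace ℝ (Fin n), 𝕜)) (f : Distrib n 𝕜) :
    Measurable (maximalFun Ψ f) :=
  (lowerSemicontinuous_iSup fun ζ =>
    (continuous_conv f (dilate Ψ ζ)).enorm.lowerSemicontinuous).measurable

end Conv

/-! ### Quantitative bounds for averages and for periodized dilates. -/

section Bounds

variable {n : ℕ} {𝕜 : Type*} [RCLike 𝕜]

theorem integral_dilate_smul {F : Type*} [NormedAddCommGroup F] [NormedSpace ℝ F]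
    (g : EuclideanSpace ℝ (Fin n) → F) (ζ : Set.Ioi (0 : ℝ)) :
    ∫ x, ((ζ : ℝ) ^ n)⁻¹ • g ((ζ : ℝ)⁻¹ • x) = ∫ x, g x := by
  have hζ : (0 : ℝ) < ζ := ζ.2
  rw [integral_smul, Measure.integral_comp_inv_smul_of_nonneg volume g hζ.le,
    finrank_euclideanSpace_fin, smul_smul, inv_mul_cancel₀ (by positivity), one_smul]

theorem integral_dilate (Ψ : 𝓢(EuclideanSpace ℝ (Fin n), 𝕜)) (ζ : Set.Ioi (0 : ℝ)) :
    ∫ x, dilate Ψ ζ x = ∫ x, Ψ x := by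
  simp only [dilate_apply]
  exact integral_dilate_smul Ψ ζ

theorem norm_dilate (Ψ : 𝓢(EuclideanSpace ℝ (Fin n), 𝕜)) (ζ : Set.Ioi (0 : ℝ))
    (x : EuclideanSpace ℝ (Fin n)) :
    ‖dilate Ψ ζ x‖ = ((ζ : ℝ) ^ n)⁻¹ * ‖Ψ ((ζ : ℝ)⁻¹ • x)‖ := by
  have hζ : (0 : ℝ) < ζ := ζ.2
  rw [dilate_apply, norm_smul, Real.norm_of_nonneg (by positivity)]

theorem integral_norm_dilate (Ψ : 𝓢(EuclideanSpace ℝ (Fin n), 𝕜)) (ζ : Set.Ioi (0 : ℝ)) :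
    ∫ x, ‖dilate Ψ ζ x‖ = ∫ x, ‖Ψ x‖ := by
  simp only [norm_dilate]
  exact integral_dilate_smul (fun x => ‖Ψ x‖) ζ

theorem integral_norm_dilate_mul_norm (Ψ : 𝓢(EuclideanSpace ℝ (Fin n), 𝕜))
    (ζ : Set.Ioi (0 : ℝ)) :
    ∫ x, ‖dilate Ψ ζ x‖ * ‖x‖ = ζ * ∫ x, ‖Ψ x‖ * ‖x‖ := by
  have hζ : (0 : ℝ) < ζ := ζ.2
  rw [← integral_dilate_smul (fun x => ‖Ψ x‖ * ‖x‖) ζ, ← integral_const_mul]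
  congr 1
  funext x
  rw [norm_dilate, norm_smul, Real.norm_of_nonneg (inv_nonneg.2 hζ.le), smul_eq_mul]
  field_simp

theorem derivSeminorm_average_le (Ψ : 𝓢(EuclideanSpace ℝ (Fin n), 𝕜)) (ζ : Set.Ioi (0 : ℝ))
    (φ : TestFun n 𝕜) (m : ℕ) :
    derivSeminorm n 𝕜 m (average (dilate Ψ ζ) φ) ≤ (∫ x, ‖Ψ x‖) * derivSeminorm n 𝕜 m φ := by
  rw [← integral_norm_dilate Ψ ζ]
  exact derivSeminorm_superpose_le φ _ _ m

theorem integrable_norm_mul_norm (Ψ : 𝓢(EuclideanSpace ℝ (Fin n), 𝕜)) :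
    Integrable fun x => ‖Ψ x‖ * ‖x‖ := by
  simpa [mul_comm] using Ψ.integrable_pow_mul volume 1

theorem iteratedFDeriv_sub_average (Ψ : 𝓢(EuclideanSpace ℝ (Fin n), 𝕜)) (φ : TestFun n 𝕜)
    (m : ℕ) (x : EuclideanSpace ℝ (Fin n)) :
    iteratedFDeriv ℝ m ((∫ z, Ψ z) • φ - average Ψ φ : TestFun n 𝕜) x =
      ∫ z, Ψ z • (iteratedFDeriv ℝ m φ x - iteratedFDeriv ℝ m φ (x + z)) := by
  have hc : ∀ y : EuclideanSpace ℝ (Fin n) → EuclideanSpace ℝ (Fin n), Continuous y →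
      Integrable fun z => Ψ z • iteratedFDeriv ℝ m φ (y z) := by
    intro y hy
    refine (Ψ.integrable.norm.mul_const (derivSeminorm n 𝕜 m φ)).mono'
      (Ψ.continuous.smul ((φ.continuous_iteratedFDeriv m).comp hy)).aestronglyMeasurable
      (ae_of_all _ fun z => ?_)
    rw [norm_smul]
    exact mul_le_mul_of_nonneg_left (φ.norm_iteratedFDeriv_le m _) (norm_nonneg _)
  have h1 : ((∫ z, Ψ z) • φ - average Ψ φ : TestFun n 𝕜) =
      (∫ z, Ψ z) • φ + (-1 : 𝕜) • average Ψ φ := by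
    rw [neg_one_smul, sub_eq_add_neg]
  have h2 : iteratedFDeriv ℝ m (average Ψ φ) x =
      ∫ z, Ψ z • iteratedFDeriv ℝ m φ (x + z) := iteratedFDeriv_superpose φ _ _ m x
  rw [h1, TestFun.iteratedFDeriv_add, TestFun.iteratedFDeriv_smul, TestFun.iteratedFDeriv_smul,
    h2, neg_one_smul, ← sub_eq_add_neg, ← integral_smul_const,
    ← integral_sub (hc (fun _ => x) continuous_const) (hc (fun z => x + z) (by fun_prop))]
  simp only [smul_sub]

/-- The mean value inequality bounds the integrand by `|Ψ_ζ(z)| |z|` times one more derivative of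
`φ`, and the first moment of `Ψ_ζ` is `ζ` times that of `Ψ`. -/
theorem derivSeminorm_sub_average_le (Ψ : 𝓢(EuclideanSpace ℝ (Fin n), 𝕜)) (ζ : Set.Ioi (0 : ℝ))
    (φ : TestFun n 𝕜) (m : ℕ) :
    derivSeminorm n 𝕜 m ((∫ x, Ψ x) • φ - average (dilate Ψ ζ) φ) ≤
      ζ * (∫ x, ‖Ψ x‖ * ‖x‖) * derivSeminorm n 𝕜 (m + 1) φ := by
  refine derivSeminorm_le fun x => ?_
  rw [← integral_norm_dilate_mul_norm, ← integral_dilate Ψ ζ, iteratedFDeriv_sub_average,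
    ← integral_mul_const]
  refine norm_integral_le_of_norm_le ((integrable_norm_mul_norm _).mul_const _)
    (ae_of_all _ fun z => ?_)
  rw [norm_smul, mul_assoc]
  refine mul_le_mul_of_nonneg_left ?_ (norm_nonneg _)
  have h := φ.norm_iteratedFDeriv_sub_le m x (x + z)
  rw [sub_add_cancel_left, norm_neg, mul_comm] at h
  exact h

theorem exists_decay (Ψ : 𝓢(EuclideanSpace ℝ (Fin n), 𝕜)) (m N : ℕ) :
    ∃ C : ℝ, 0 ≤ C ∧ ∀ x, ‖iteratedFDeriv ℝ m Ψ x‖ ≤ C * ((1 + ‖x‖) ^ N)⁻¹ := by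
  refine ⟨2 ^ N * ((Finset.Iic (N, m)).sup fun m => SchwartzMap.seminorm ℝ m.1 m.2) Ψ,
    by positivity, fun x => ?_⟩
  rw [← div_eq_mul_inv, le_div_iff₀ (by positivity), mul_comm]
  exact SchwartzMap.one_add_le_sup_seminorm_apply (𝕜 := ℝ) (m := (N, m)) le_rfl le_rfl Ψ x

/-- Peetre's inequality: a bounded translation changes polynomial weights only by a constant factor.
-/
theorem inv_one_add_norm_add_pow_le {V : Type*} [NormedAddCommGroup V] {x v : V} {R : ℝ}
    (hx : ‖x‖ ≤ R) (N : ℕ) :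
    ((1 + ‖x + v‖) ^ N)⁻¹ ≤ (1 + R) ^ N * ((1 + ‖v‖) ^ N)⁻¹ := by
  have h1 : ‖v‖ ≤ ‖x + v‖ + ‖x‖ := by
    have := norm_sub_le (x + v) x
    rwa [add_sub_cancel_left] at this
  have h2 : 1 + ‖v‖ ≤ (1 + R) * (1 + ‖x + v‖) := by
    nlinarith [norm_nonneg x, norm_nonneg (x + v)]
  have h3 := pow_le_pow_left₀ (by positivity) h2 N
  rw [mul_pow] at h3
  rw [← div_eq_mul_inv, le_div_iff₀ (by positivity), inv_mul_le_iff₀ (by positivity), mul_comm]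
  exact h3

theorem summable_inv_one_add_norm_latticeVec {N : ℕ} (hN : n < N) :
    Summable fun k : Fin n → ℤ => ((1 + ‖latticeVec k‖) ^ N)⁻¹ := by
  refine Summable.of_norm_bounded_eventually (summable_latticeVec hN) ?_
  have hne : ∀ᶠ k : Fin n → ℤ in Filter.cofinite, k ≠ 0 := by
    simp [Filter.eventually_cofinite]
  filter_upwards [hne] with k hk
  have hk0 : 0 < ‖latticeVec k‖ := by
    rw [norm_pos_iff]
    intro h
    apply hk
    funext i
    have h2 := congrArg (fun v : EuclideanSpace ℝ (Fin n) => v i) h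
    simpa [latticeVec] using h2
  rw [Real.norm_of_nonneg (by positivity), ← inv_pow]
  gcongr
  linarith

theorem exists_decay_translates (Ψ : 𝓢(EuclideanSpace ℝ (Fin n), 𝕜)) (m : ℕ) (R : ℝ)
    (hR : 0 ≤ R) : ∃ C : ℝ, 0 ≤ C ∧ ∀ (k : Fin n → ℤ) (x : EuclideanSpace ℝ (Fin n)), ‖x‖ ≤ R →
      ‖iteratedFDeriv ℝ m Ψ (x + latticeVec k)‖ ≤ C * ((1 + ‖latticeVec k‖) ^ (n + 1))⁻¹ := by
  obtain ⟨C, hC, h⟩ := exists_decay Ψ m (n + 1)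
  refine ⟨C * (1 + R) ^ (n + 1), by positivity, fun k x hx => (h _).trans ?_⟩
  rw [mul_assoc]
  exact mul_le_mul_of_nonneg_left (inv_one_add_norm_add_pow_le hx (n + 1)) hC

theorem dominated_translates (Ψ : 𝓢(EuclideanSpace ℝ (Fin n), 𝕜)) (m : ℕ)
    (x₀ : EuclideanSpace ℝ (Fin n)) :
    ∃ b : (Fin n → ℤ) → ℝ, Integrable b Measure.count ∧ ∀ k, ∀ x ∈ ball x₀ 1,
      ‖iteratedFDeriv ℝ m (fun y => Ψ (y + latticeVec k)) x‖ ≤ b k := by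
  obtain ⟨C, -, h⟩ := exists_decay_translates Ψ m (‖x₀‖ + 1) (by positivity)
  refine ⟨fun k => C * ((1 + ‖latticeVec k‖) ^ (n + 1))⁻¹, ?_, fun k x hx => ?_⟩
  · exact integrable_count_iff.2
      ((summable_inv_one_add_norm_latticeVec (Nat.lt_succ_self n)).mul_left C).norm
  · rw [iteratedFDeriv_comp_add_right]
    refine h k x ?_
    have h1 : ‖x - x₀‖ < 1 := mem_ball_iff_norm.1 hx
    have h2 := norm_add_le x₀ (x - x₀)
    rw [add_sub_cancel] at h2
    linarith

/-- The lattice sum is read as an integral for counting measure, so termwise differentiation is an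
instance of differentiation under the integral. -/
theorem iteratedFDeriv_periodization (Ψ : 𝓢(EuclideanSpace ℝ (Fin n), 𝕜)) (m : ℕ)
    (x : EuclideanSpace ℝ (Fin n)) :
    iteratedFDeriv ℝ m (periodization Ψ) x =
      ∫ k : Fin n → ℤ, iteratedFDeriv ℝ m Ψ (x + latticeVec k) ∂Measure.count := by
  have hmeas : ∀ m x, AEStronglyMeasurable
      (fun k : Fin n → ℤ => iteratedFDeriv ℝ m (fun y => Ψ (y + latticeVec k)) x)
      Measure.count := fun m x => AEStronglyMeasurable.of_discrete
  have hper : (periodization Ψ : EuclideanSpace ℝ (Fin n) → 𝕜) =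
      fun x => ∫ k : Fin n → ℤ, Ψ (x + latticeVec k) ∂Measure.count := by
    funext x
    have hi := integrable_iteratedFDeriv_of_dominated hmeas (dominated_translates Ψ) 0 x
    have hi' : Integrable (fun k : Fin n → ℤ => Ψ (x + latticeVec k)) Measure.count := by
      refine (integrable_norm_iff AEStronglyMeasurable.of_discrete).1 ?_
      simpa using hi.norm
    rw [integral_countable hi']
    simp only [measureReal_def, Measure.count_singleton, ENNReal.toReal_one, one_smul]
    rfl
  rw [hper, iteratedFDeriv_integral (H := fun (k : Fin n → ℤ) y => Ψ (y + latticeVec k))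
    (fun k => (Ψ.smooth ⊤).comp (contDiff_id.add contDiff_const)) hmeas (dominated_translates Ψ)]
  simp only [iteratedFDeriv_comp_add_right]

theorem norm_iteratedFDeriv_dilate (Ψ : 𝓢(EuclideanSpace ℝ (Fin n), 𝕜)) (ζ : Set.Ioi (0 : ℝ))
    (m : ℕ) (x : EuclideanSpace ℝ (Fin n)) :
    ‖iteratedFDeriv ℝ m (dilate Ψ ζ) x‖ =
      ((ζ : ℝ) ^ (n + m))⁻¹ * ‖iteratedFDeriv ℝ m Ψ ((ζ : ℝ)⁻¹ • x)‖ := by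
  have hζ : (0 : ℝ) < ζ := ζ.2
  have h : (dilate Ψ ζ : EuclideanSpace ℝ (Fin n) → 𝕜) =
      ((ζ : ℝ) ^ n)⁻¹ • fun x => Ψ ((ζ : ℝ)⁻¹ • x) := by
    funext x
    exact dilate_apply Ψ ζ x
  have hs : ContDiff ℝ m Ψ := Ψ.smooth m
  have hs' : ContDiff ℝ m fun x => Ψ ((ζ : ℝ)⁻¹ • x) := hs.comp (contDiff_const_smul _)
  rw [h, iteratedFDeriv_const_smul_apply hs'.contDiffAt, iteratedFDeriv_comp_const_smul _ hs, norm_smul,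
    norm_smul, Real.norm_of_nonneg (by positivity), Real.norm_of_nonneg (by positivity), pow_add,
    mul_inv, inv_pow, mul_assoc]

theorem exists_latticeVec_norm_le (x : EuclideanSpace ℝ (Fin n)) :
    ∃ k : Fin n → ℤ, ‖x + latticeVec k‖ ≤ Real.sqrt n := by
  refine ⟨fun i => -⌊x i⌋, ?_⟩
  rw [EuclideanSpace.norm_eq]
  refine Real.sqrt_le_sqrt ?_
  calc ∑ i, ‖(x + latticeVec fun i => -⌊x i⌋ : EuclideanSpace ℝ (Fin n)) i‖ ^ 2
      ≤ ∑ _i : Fin n, (1 : ℝ) := by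
        refine Finset.sum_le_sum fun i _ => ?_
        have h0 : (x + latticeVec fun i => -⌊x i⌋ : EuclideanSpace ℝ (Fin n)) i
            = Int.fract (x i) := by
          simp [latticeVec, Int.fract, sub_eq_add_neg]
        rw [h0, Real.norm_eq_abs, abs_of_nonneg (Int.fract_nonneg _)]
        exact pow_le_one₀ (Int.fract_nonneg _) (Int.fract_lt_one _).le
    _ = n := by simp

/-- The periodized dilates of a Schwartz function grow at most polynomially in `ζ⁻¹`. -/
theorem exists_derivSeminorm_periodization_dilate_le (Ψ : 𝓢(EuclideanSpace ℝ (Fin n), 𝕜))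
    (m : ℕ) : ∃ C : ℝ, 0 ≤ C ∧ ∀ ζ : Set.Ioi (0 : ℝ), (ζ : ℝ) ≤ 1 →
      derivSeminorm n 𝕜 m (periodization (dilate Ψ ζ)) ≤ C * ((ζ : ℝ) ^ (n + m))⁻¹ := by
  obtain ⟨C, hC, h⟩ := exists_decay Ψ m (n + 1)
  have hsum := summable_inv_one_add_norm_latticeVec (Nat.lt_succ_self n)
  let R := Real.sqrt n
  refine ⟨C * (1 + R) ^ (n + 1) * ∫ k : Fin n → ℤ, ((1 + ‖latticeVec k‖) ^ (n + 1))⁻¹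
    ∂Measure.count, ?_, fun ζ hζ1 => derivSeminorm_le fun y => ?_⟩
  · have : 0 ≤ ∫ k : Fin n → ℤ, ((1 + ‖latticeVec k‖) ^ (n + 1))⁻¹ ∂Measure.count :=
      integral_nonneg fun k => by positivity
    positivity
  have hζ : (0 : ℝ) < ζ := ζ.2
  obtain ⟨l, hl⟩ := exists_latticeVec_norm_le y
  have hy : iteratedFDeriv ℝ m (periodization (dilate Ψ ζ)) y =
      iteratedFDeriv ℝ m (periodization (dilate Ψ ζ)) (y + latticeVec l) := by
    rw [← iteratedFDeriv_shift]
    congr 2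
    exact ext_apply fun x => ((periodization (dilate Ψ ζ)).periodic l x).symm
  rw [hy, iteratedFDeriv_periodization, mul_right_comm, ← integral_const_mul]
  refine norm_integral_le_of_norm_le
    ((integrable_count_iff.2 hsum.norm).const_mul _) (ae_of_all _ fun k => ?_)
  rw [norm_iteratedFDeriv_dilate]
  set v := y + latticeVec l + latticeVec k
  -- Since `ζ ≤ 1`, dilation only improves the decay. The lattice sum is therefore bounded uniformly
  -- in `ζ`, and only the scaling factor `ζ^(-n-m)` remains.
  have h1 : ‖v‖ ≤ ‖(ζ : ℝ)⁻¹ • v‖ := by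
    rw [norm_smul, Real.norm_of_nonneg (inv_nonneg.2 hζ.le)]
    exact le_mul_of_one_le_left (norm_nonneg _) ((one_le_inv₀ hζ).2 hζ1)
  have h2 : ‖iteratedFDeriv ℝ m Ψ ((ζ : ℝ)⁻¹ • v)‖ ≤
      C * ((1 + R) ^ (n + 1) * ((1 + ‖latticeVec k‖) ^ (n + 1))⁻¹) := by
    refine (h _).trans (mul_le_mul_of_nonneg_left ?_ hC)
    refine le_trans ?_ (inv_one_add_norm_add_pow_le hl (n + 1))
    gcongr
  calc _ ≤ ((ζ : ℝ) ^ (n + m))⁻¹ *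
        (C * ((1 + R) ^ (n + 1) * ((1 + ‖latticeVec k‖) ^ (n + 1))⁻¹)) := by gcongr
    _ = _ := by ring

/-- The constant depends on `Ψ` and `L` only, while `f` enters through `B` alone. This uniformity
lets `B` be optimized later. -/
theorem exists_norm_conv_dilate_le (Ψ : 𝓢(EuclideanSpace ℝ (Fin n), 𝕜)) (L : ℕ) :
    ∃ C : ℝ, 0 ≤ C ∧ ∀ (f : Distrib n 𝕜) (B : ℝ), 0 ≤ B →
      (∀ φ, ‖f φ‖ ≤ B * orderSeminorm n 𝕜 L φ) → ∀ (ζ : Set.Ioi (0 : ℝ)), (ζ : ℝ) ≤ 1 →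
      ∀ x, ‖conv f (dilate Ψ ζ) x‖ ≤ C * B * ((ζ : ℝ) ^ (n + L))⁻¹ := by
  choose C hC0 hC using exists_derivSeminorm_periodization_dilate_le Ψ
  have hS : 0 ≤ ∑ m ∈ Finset.range (L + 1), C m := Finset.sum_nonneg fun m _ => hC0 m
  refine ⟨∑ m ∈ Finset.range (L + 1), C m, hS, fun f B hB hf ζ hζ1 x => ?_⟩
  have hζ : (0 : ℝ) < ζ := ζ.2
  rw [mul_comm _ B, mul_assoc]
  refine (hf _).trans (mul_le_mul_of_nonneg_left ?_ hB)
  refine orderSeminorm_le (by positivity) fun m hm => ?_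
  refine (derivSeminorm_reflect_le _ x m).trans ((hC m ζ hζ1).trans ?_)
  have h1 : C m ≤ ∑ m ∈ Finset.range (L + 1), C m :=
    Finset.single_le_sum (f := C) (fun i _ => hC0 i) (Finset.mem_range.2 (by omega))
  have h2 : ((ζ : ℝ) ^ (n + L)) ≤ (ζ : ℝ) ^ (n + m) :=
    pow_le_pow_of_le_one hζ.le hζ1 (by omega)
  gcongr

end Bounds

/-! ### Resolution of a test function into averages at geometric scales. -/

section Resolution

variable {n : ℕ} {𝕜 : Type*} [RCLike 𝕜]

/-- The error `φ - c⁻¹ ∫ Ψ_ζ(z) φ(· + z) dz` in approximating a test function by its average at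
scale `ζ`, where `c = ∫ Ψ`. -/
def averageError (Ψ : 𝓢(EuclideanSpace ℝ (Fin n), 𝕜)) (ζ : Set.Ioi (0 : ℝ)) (φ : TestFun n 𝕜) :
    TestFun n 𝕜 :=
  φ - (∫ x, Ψ x)⁻¹ • average (dilate Ψ ζ) φ

/-- A bound for the operator `averageError`. -/
def averageErrorBound (Ψ : 𝓢(EuclideanSpace ℝ (Fin n), 𝕜)) : ℝ :=
  1 + ‖∫ x, Ψ x‖⁻¹ * ((∫ x, ‖Ψ x‖) + ∫ x, ‖Ψ x‖ * ‖x‖)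

theorem one_le_averageErrorBound (Ψ : 𝓢(EuclideanSpace ℝ (Fin n), 𝕜)) :
    1 ≤ averageErrorBound Ψ := by
  have h1 : 0 ≤ ∫ x, ‖Ψ x‖ := integral_nonneg fun x => norm_nonneg _
  have h2 : 0 ≤ ∫ x, ‖Ψ x‖ * ‖x‖ := integral_nonneg fun x => by positivity
  have h3 : 0 ≤ ‖∫ x, Ψ x‖⁻¹ * ((∫ x, ‖Ψ x‖) + ∫ x, ‖Ψ x‖ * ‖x‖) := by positivity
  unfold averageErrorBound
  linarith

theorem derivSeminorm_averageError_le (Ψ : 𝓢(EuclideanSpace ℝ (Fin n), 𝕜)) (ζ : Set.Ioi (0 : ℝ))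
    (φ : TestFun n 𝕜) (m : ℕ) :
    derivSeminorm n 𝕜 m (averageError Ψ ζ φ) ≤ averageErrorBound Ψ * derivSeminorm n 𝕜 m φ := by
  have h2 : 0 ≤ ∫ x, ‖Ψ x‖ * ‖x‖ := integral_nonneg fun x => by positivity
  have hφ : 0 ≤ derivSeminorm n 𝕜 m φ := apply_nonneg _ _
  calc derivSeminorm n 𝕜 m (averageError Ψ ζ φ)
      ≤ derivSeminorm n 𝕜 m φ +
          derivSeminorm n 𝕜 m ((∫ x, Ψ x)⁻¹ • average (dilate Ψ ζ) φ) := map_sub_le_add _ _ _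
    _ = derivSeminorm n 𝕜 m φ +
          ‖∫ x, Ψ x‖⁻¹ * derivSeminorm n 𝕜 m (average (dilate Ψ ζ) φ) := by
        rw [map_smul_eq_mul, norm_inv]
    _ ≤ derivSeminorm n 𝕜 m φ + ‖∫ x, Ψ x‖⁻¹ *
          (((∫ x, ‖Ψ x‖) + ∫ x, ‖Ψ x‖ * ‖x‖) * derivSeminorm n 𝕜 m φ) := by
        gcongr
        refine (derivSeminorm_average_le Ψ ζ φ m).trans ?_
        gcongr
        linarith
    _ = averageErrorBound Ψ * derivSeminorm n 𝕜 m φ := by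
        unfold averageErrorBound
        ring

theorem derivSeminorm_averageError_le_mul {Ψ : 𝓢(EuclideanSpace ℝ (Fin n), 𝕜)}
    (hΨ : (∫ x, Ψ x) ≠ 0) (ζ : Set.Ioi (0 : ℝ)) (φ : TestFun n 𝕜) (m : ℕ) :
    derivSeminorm n 𝕜 m (averageError Ψ ζ φ) ≤
      averageErrorBound Ψ * ζ * derivSeminorm n 𝕜 (m + 1) φ := by
  have hζ : (0 : ℝ) < ζ := ζ.2
  have h1 : 0 ≤ ∫ x, ‖Ψ x‖ := integral_nonneg fun x => norm_nonneg _
  have hφ : 0 ≤ derivSeminorm n 𝕜 (m + 1) φ := apply_nonneg _ _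
  have h : averageError Ψ ζ φ =
      (∫ x, Ψ x)⁻¹ • ((∫ x, Ψ x) • φ - average (dilate Ψ ζ) φ) := by
    rw [averageError, smul_sub, smul_smul, inv_mul_cancel₀ hΨ, one_smul]
  rw [h, map_smul_eq_mul, norm_inv]
  calc _ ≤ ‖∫ x, Ψ x‖⁻¹ *
        (ζ * (∫ x, ‖Ψ x‖ * ‖x‖) * derivSeminorm n 𝕜 (m + 1) φ) := by
        gcongr
        exact derivSeminorm_sub_average_le Ψ ζ φ m
    _ = ‖∫ x, Ψ x‖⁻¹ * (∫ x, ‖Ψ x‖ * ‖x‖) * (ζ * derivSeminorm n 𝕜 (m + 1) φ) := by ring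
    _ ≤ averageErrorBound Ψ * (ζ * derivSeminorm n 𝕜 (m + 1) φ) := by
        gcongr
        unfold averageErrorBound
        have h3 : 0 ≤ ‖∫ x, Ψ x‖⁻¹ * ∫ x, ‖Ψ x‖ := by positivity
        rw [mul_add]
        linarith
    _ = _ := by ring

/-- The ratio of consecutive scales in the resolution of a test function. -/
def scaleRatio (Ψ : 𝓢(EuclideanSpace ℝ (Fin n), 𝕜)) : ℝ := (2 * averageErrorBound Ψ)⁻¹

theorem scaleRatio_pos (Ψ : 𝓢(EuclideanSpace ℝ (Fin n), 𝕜)) : 0 < scaleRatio Ψ := by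
  have := one_le_averageErrorBound Ψ
  unfold scaleRatio
  positivity

theorem scaleRatio_le_one (Ψ : 𝓢(EuclideanSpace ℝ (Fin n), 𝕜)) : scaleRatio Ψ ≤ 1 := by
  have := one_le_averageErrorBound Ψ
  exact inv_le_one_of_one_le₀ (by linarith)

theorem averageErrorBound_mul_scaleRatio (Ψ : 𝓢(EuclideanSpace ℝ (Fin n), 𝕜)) :
    averageErrorBound Ψ * scaleRatio Ψ = 1 / 2 := by
  have := one_le_averageErrorBound Ψ
  unfold scaleRatio
  field_simp

/-- The geometric sequence of scales. -/
def scale (Ψ : 𝓢(EuclideanSpace ℝ (Fin n), 𝕜)) (j : ℕ) : Set.Ioi (0 : ℝ) :=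
  ⟨scaleRatio Ψ ^ j, pow_pos (scaleRatio_pos Ψ) j⟩

/-- The remainders in the resolution of a test function into averages at finer and finer scales. -/
def remainder (Ψ : 𝓢(EuclideanSpace ℝ (Fin n), 𝕜)) (φ : TestFun n 𝕜) : ℕ → TestFun n 𝕜
  | 0 => φ
  | j + 1 => averageError Ψ (scale Ψ j) (remainder Ψ φ j)

/-- Induction on `K`: the last step spends one derivative to gain a factor `r^j`, and the earlier
steps supply the other `K`. The scales of these steps lag behind the final one by a bounded index
shift, which the constant absorbs as powers of `r⁻¹`. Steps not spending a derivative cost a factor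
`averageErrorBound Ψ`. -/
theorem exists_derivSeminorm_remainder_le {Ψ : 𝓢(EuclideanSpace ℝ (Fin n), 𝕜)}
    (hΨ : (∫ x, Ψ x) ≠ 0) (K : ℕ) : ∃ C : ℝ, 1 ≤ C ∧ ∀ φ m j,
      derivSeminorm n 𝕜 m (remainder Ψ φ j) ≤
        C * (averageErrorBound Ψ ^ j * (scaleRatio Ψ ^ j) ^ K) *
          orderSeminorm n 𝕜 (m + K) φ := by
  have hD := one_le_averageErrorBound Ψ
  have hr := scaleRatio_pos Ψ
  induction K with
  | zero =>
    refine ⟨1, le_rfl, fun φ m j => ?_⟩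
    rw [pow_zero, one_mul, mul_one, add_zero]
    induction j with
    | zero => simpa [remainder] using derivSeminorm_le_orderSeminorm le_rfl φ
    | succ j ih =>
      refine (derivSeminorm_averageError_le Ψ _ _ m).trans ?_
      rw [pow_succ', mul_assoc]
      gcongr
  | succ K ih =>
    obtain ⟨C, hC, h⟩ := ih
    have hr1 : 1 ≤ (scaleRatio Ψ ^ (K + 1))⁻¹ :=
      (one_le_inv₀ (by positivity)).2 (pow_le_one₀ hr.le (scaleRatio_le_one Ψ))
    have hC1 : 1 ≤ C * (scaleRatio Ψ ^ (K + 1))⁻¹ := one_le_mul_of_one_le_of_one_le hC hr1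
    refine ⟨C * (scaleRatio Ψ ^ (K + 1))⁻¹, hC1, fun φ m j => ?_⟩
    cases j with
    | zero =>
      rw [pow_zero, pow_zero, one_pow, mul_one, mul_one]
      exact (derivSeminorm_le_orderSeminorm (by omega) φ).trans
        (le_mul_of_one_le_left (apply_nonneg _ _) hC1)
    | succ j =>
      refine (derivSeminorm_averageError_le_mul hΨ _ _ m).trans ?_
      have h1 := h φ (m + 1) j
      rw [show m + 1 + K = m + (K + 1) by omega] at h1
      have h2 : ((scale Ψ j : Set.Ioi (0 : ℝ)) : ℝ) = scaleRatio Ψ ^ j := rfl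
      rw [h2]
      calc _ ≤ averageErrorBound Ψ * scaleRatio Ψ ^ j *
            (C * (averageErrorBound Ψ ^ j * (scaleRatio Ψ ^ j) ^ K) *
              orderSeminorm n 𝕜 (m + (K + 1)) φ) := by gcongr
        _ = _ := by
          field_simp
          ring

/-- One derivative beyond `K` pays for the accumulated operator bounds: the scale ratio is chosen so
that its product with `averageErrorBound Ψ` is `1/2`. -/
theorem exists_derivSeminorm_remainder_le_half {Ψ : 𝓢(EuclideanSpace ℝ (Fin n), 𝕜)}
    (hΨ : (∫ x, Ψ x) ≠ 0) (K : ℕ) : ∃ C : ℝ, 0 ≤ C ∧ ∀ φ m j,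
      derivSeminorm n 𝕜 m (remainder Ψ φ j) ≤
        C * (1 / 2) ^ j * (scaleRatio Ψ ^ j) ^ K * orderSeminorm n 𝕜 (m + (K + 1)) φ := by
  obtain ⟨C, hC, h⟩ := exists_derivSeminorm_remainder_le hΨ (K + 1)
  refine ⟨C, by linarith, fun φ m j => (h φ m j).trans_eq ?_⟩
  rw [← averageErrorBound_mul_scaleRatio Ψ, mul_pow, pow_succ]
  ring

theorem map_eq_sum_add_remainder (Ψ : 𝓢(EuclideanSpace ℝ (Fin n), 𝕜)) (f : Distrib n 𝕜)
    (φ : TestFun n 𝕜) (N : ℕ) :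
    f φ = ∑ j ∈ Finset.range N,
      (∫ x, Ψ x)⁻¹ * f (average (dilate Ψ (scale Ψ j)) (remainder Ψ φ j)) +
        f (remainder Ψ φ N) := by
  induction N with
  | zero => simp [remainder]
  | succ N ih =>
    have h : f (remainder Ψ φ (N + 1)) = f (remainder Ψ φ N) -
        (∫ x, Ψ x)⁻¹ * f (average (dilate Ψ (scale Ψ N)) (remainder Ψ φ N)) := by
      change f (remainder Ψ φ N - _ • _) = _
      rw [map_sub, map_smul, smul_eq_mul]
    rw [Finset.sum_range_succ, h, ih]
    ring

end Resolution

/-! ### The a priori estimate. -/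

section APriori

variable {n : ℕ} {𝕜 : Type*} [RCLike 𝕜]

theorem integral_norm_le_of_bound {α : Type*} [MeasurableSpace α] {μ : Measure α}
    [IsFiniteMeasure μ] {u : α → 𝕜} (hu : AEStronglyMeasurable u μ) {p M A : ℝ} (hp0 : 0 < p)
    (hp1 : p ≤ 1) (hM0 : 0 ≤ M) (hM : ∀ x, ‖u x‖ ≤ M) (hA : ∫ x, ‖u x‖ ^ p ∂μ ≤ A) :
    Integrable u μ ∧ ∫ x, ‖u x‖ ∂μ ≤ M ^ (1 - p) * A := by
  have hui : Integrable u μ := (integrable_const M).mono' hu (ae_of_all _ hM)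
  refine ⟨hui, ?_⟩
  have hpi : Integrable (fun x => ‖u x‖ ^ p) μ := by
    refine (integrable_const (M ^ p)).mono'
      ((Real.continuous_rpow_const hp0.le).comp_aestronglyMeasurable hu.norm)
      (ae_of_all _ fun x => ?_)
    rw [Real.norm_of_nonneg (by positivity)]
    exact Real.rpow_le_rpow (norm_nonneg _) (hM x) hp0.le
  calc ∫ x, ‖u x‖ ∂μ ≤ ∫ x, M ^ (1 - p) * ‖u x‖ ^ p ∂μ := by
        refine integral_mono hui.norm (hpi.const_mul _) fun x => ?_
        have h : ‖u x‖ = ‖u x‖ ^ (1 - p) * ‖u x‖ ^ p := by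
          rw [← Real.rpow_add_of_nonneg (norm_nonneg _) (by linarith) hp0.le, sub_add_cancel,
            Real.rpow_one]
        refine h.trans_le (mul_le_mul_of_nonneg_right ?_ (by positivity))
        exact Real.rpow_le_rpow (norm_nonneg _) (hM x) (by linarith)
    _ = M ^ (1 - p) * ∫ x, ‖u x‖ ^ p ∂μ := integral_const_mul _ _
    _ ≤ M ^ (1 - p) * A := by gcongr

/-- A distribution whose regularizations are bounded in `L^p` improves its own order. -/
theorem exists_improved_bound {Ψ : 𝓢(EuclideanSpace ℝ (Fin n), 𝕜)} (hΨ : (∫ x, Ψ x) ≠ 0)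
    {p : ℝ} (hp0 : 0 < p) (hp1 : p ≤ 1) {L K : ℕ} (hK : ((n + L : ℕ) : ℝ) * (1 - p) ≤ K) :
    ∃ C : ℝ, 0 ≤ C ∧ ∀ (f : Distrib n 𝕜) (A B : ℝ), 0 ≤ B →
      (∀ ζ, ∫ x, ‖conv f (dilate Ψ ζ) x‖ ^ p ∂cellMeasure n ≤ A) →
      (∀ φ, ‖f φ‖ ≤ B * orderSeminorm n 𝕜 L φ) →
      ∀ φ, ‖f φ‖ ≤ C * B ^ (1 - p) * A * orderSeminorm n 𝕜 (K + 1) φ := by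
  obtain ⟨C₁, hC₁, h₁⟩ := exists_norm_conv_dilate_le Ψ L
  obtain ⟨C₂, hC₂, h₂⟩ := exists_derivSeminorm_remainder_le_half hΨ K
  obtain ⟨C₃, hC₃, h₃⟩ := exists_derivSeminorm_remainder_le_half hΨ 0
  have hr := scaleRatio_pos Ψ
  have hr1 := scaleRatio_le_one Ψ
  refine ⟨‖∫ x, Ψ x‖⁻¹ * C₂ * C₁ ^ (1 - p) * 2, by positivity, fun f A B hB hA hf φ => ?_⟩
  have hA0 : 0 ≤ A := (integral_nonneg fun x => by positivity).trans (hA (scale Ψ 0))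
  let M := orderSeminorm n 𝕜 (K + 1) φ
  have hM : 0 ≤ M := apply_nonneg _ _
  let Q := ‖∫ x, Ψ x‖⁻¹ * C₂ * C₁ ^ (1 - p) * B ^ (1 - p) * A * M
  have hQ : 0 ≤ Q := by positivity
  have hterm : ∀ j, ‖(∫ x, Ψ x)⁻¹ * f (average (dilate Ψ (scale Ψ j)) (remainder Ψ φ j))‖ ≤
      Q * (1 / 2) ^ j := by
    intro j
    let t : ℝ := scaleRatio Ψ ^ j
    have ht : 0 < t := pow_pos hr j
    have ht1 : t ≤ 1 := pow_le_one₀ hr.le hr1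
    have hu : ∀ x, ‖conv f (dilate Ψ (scale Ψ j)) x‖ ≤ C₁ * B * (t ^ (n + L))⁻¹ :=
      h₁ f B hB hf (scale Ψ j) ht1
    obtain ⟨hui, hu1⟩ := integral_norm_le_of_bound (μ := cellMeasure n)
      (continuous_conv f (dilate Ψ (scale Ψ j))).aestronglyMeasurable hp0 hp1 (by positivity) hu
      (hA (scale Ψ j))
    have hφ := h₂ φ 0 j
    rw [zero_add] at hφ
    -- The exponent `K - (n + L)(1 - p)` is nonnegative by `hK`, so the decay of the remainder
    -- absorbs the growth of the convolution.
    have ht2 : t ^ K * ((t ^ (n + L))⁻¹) ^ (1 - p) ≤ 1 := by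
      rw [← Real.rpow_natCast, ← Real.rpow_natCast, ← Real.rpow_neg ht.le,
        ← Real.rpow_mul ht.le, ← Real.rpow_add ht]
      exact Real.rpow_le_one ht.le ht1 (by linarith)
    have hint : ‖∫ x, remainder Ψ φ j x * conv f (dilate Ψ (scale Ψ j)) x ∂cellMeasure n‖ ≤
        derivSeminorm n 𝕜 0 (remainder Ψ φ j) *
          ∫ x, ‖conv f (dilate Ψ (scale Ψ j)) x‖ ∂cellMeasure n := by
      rw [← integral_const_mul]
      refine norm_integral_le_of_norm_le (hui.norm.const_mul _) (ae_of_all _ fun x => ?_)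
      rw [norm_mul]
      exact mul_le_mul_of_nonneg_right (norm_apply_le _ x) (norm_nonneg _)
    rw [norm_mul, norm_inv, f.map_average]
    calc _ ≤ ‖∫ x, Ψ x‖⁻¹ * ((C₂ * (1 / 2) ^ j * t ^ K * M) *
          ((C₁ * B * (t ^ (n + L))⁻¹) ^ (1 - p) * A)) := by
          refine mul_le_mul_of_nonneg_left (hint.trans ?_) (by positivity)
          exact mul_le_mul hφ hu1 (integral_nonneg fun x => norm_nonneg _) (by positivity)
      _ = Q * (1 / 2) ^ j * (t ^ K * ((t ^ (n + L))⁻¹) ^ (1 - p)) := by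
          rw [Real.mul_rpow (by positivity) (by positivity), Real.mul_rpow hC₁ hB]
          ring
      _ ≤ Q * (1 / 2) ^ j * 1 := by gcongr
      _ = _ := mul_one _
  -- The order of `f` is used on the final remainder only qualitatively: this term involves more
  -- derivatives of `φ`, but it vanishes as `N → ∞` and leaves no trace in the bound.
  have hbound : ∀ N, ‖f φ‖ ≤ Q * 2 +
      B * (C₃ * (1 / 2) ^ N * orderSeminorm n 𝕜 (L + 1) φ) := by
    intro N
    rw [map_eq_sum_add_remainder Ψ f φ N]
    refine (norm_add_le _ _).trans (add_le_add ?_ ?_)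
    · refine (norm_sum_le_of_le _ fun j _ => hterm j).trans ?_
      rw [← Finset.mul_sum]
      gcongr
      have h := (summable_geometric_two).sum_le_tsum (Finset.range N) fun i _ => by positivity
      rwa [tsum_geometric_two] at h
    · refine (hf _).trans (mul_le_mul_of_nonneg_left ?_ hB)
      refine orderSeminorm_le (by positivity) fun m hm => ?_
      refine (h₃ φ m N).trans ?_
      rw [pow_zero, mul_one]
      gcongr
      exact orderSeminorm_mono (by omega) φ
  have hlim : Tendsto (fun N : ℕ => Q * 2 +
      B * (C₃ * (1 / 2) ^ N * orderSeminorm n 𝕜 (L + 1) φ)) atTop (𝓝 (Q * 2 +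
        B * (C₃ * 0 * orderSeminorm n 𝕜 (L + 1) φ))) := by
    have h := tendsto_pow_atTop_nhds_zero_of_lt_one (r := (1 / 2 : ℝ)) (by norm_num) (by norm_num)
    exact (((h.const_mul C₃).mul_const _).const_mul B).const_add _
  refine (ge_of_tendsto' hlim hbound).trans_eq ?_
  simp only [Q, M]
  ring

/-- Boundedness in `L^p` of the regularizations controls a distribution quantitatively. -/
theorem exists_norm_apply_le {Ψ : 𝓢(EuclideanSpace ℝ (Fin n), 𝕜)} (hΨ : (∫ x, Ψ x) ≠ 0)
    {p : ℝ} (hp0 : 0 < p) (hp1 : p ≤ 1) :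
    ∃ (L : ℕ) (C : ℝ), 0 ≤ C ∧ ∀ (f : Distrib n 𝕜) (A : ℝ),
      (∀ ζ, ∫ x, ‖conv f (dilate Ψ ζ) x‖ ^ p ∂cellMeasure n ≤ A) →
      ∀ φ, ‖f φ‖ ≤ C * A ^ p⁻¹ * orderSeminorm n 𝕜 L φ := by
  have hK : ∀ L : ℕ, ((n + L : ℕ) : ℝ) * (1 - p) ≤ ⌈((n + L : ℕ) : ℝ) * (1 - p)⌉₊ :=
    fun L => Nat.le_ceil _
  -- The new order is less than `(n + L)(1 - p) + 2`, which is at most `L` once `p L ≥ n + 2`.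
  have hKL : ∀ L : ℕ, ((n : ℝ) + 2) / p ≤ L → ⌈((n + L : ℕ) : ℝ) * (1 - p)⌉₊ + 1 < L := by
    intro L hL
    rw [div_le_iff₀ hp0] at hL
    have h1 := Nat.ceil_lt_add_one (a := ((n + L : ℕ) : ℝ) * (1 - p))
      (mul_nonneg (Nat.cast_nonneg _) (by linarith))
    have h2 : (0 : ℝ) ≤ n * p := by positivity
    have h3 : ((⌈((n + L : ℕ) : ℝ) * (1 - p)⌉₊ + 1 : ℕ) : ℝ) < L := by
      push_cast at h1 ⊢
      nlinarith
    exact_mod_cast h3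
  let L₀ := ⌈((n : ℝ) + 2) / p⌉₊
  obtain ⟨C, hC, himp⟩ := exists_improved_bound hΨ hp0 hp1 (hK L₀)
  refine ⟨L₀, C ^ p⁻¹, by positivity, fun f A hA => ?_⟩
  have hA0 : 0 ≤ A := (integral_nonneg fun x => by positivity).trans (hA (scale Ψ 0))
  let s : Set ℝ := {B | 0 ≤ B ∧ ∀ φ, ‖f φ‖ ≤ B * orderSeminorm n 𝕜 L₀ φ}
  -- The least order of `f` cannot exceed `L₀`, since above this threshold the improvement strictly
  -- lowers it. The constant obtained here may depend on `f`.
  have hs : s.Nonempty := by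
    classical
    have hex : ∃ L : ℕ, ∃ B : ℝ, 0 ≤ B ∧ ∀ φ, ‖f φ‖ ≤ B * orderSeminorm n 𝕜 L φ := f.exists_order
    obtain ⟨B, hB, hfB⟩ := Nat.find_spec hex
    by_cases hL : Nat.find hex ≤ L₀
    · exact ⟨B, hB, fun φ => (hfB φ).trans (by gcongr; exact orderSeminorm_mono hL φ)⟩
    · obtain ⟨C', hC', h'⟩ := exists_improved_bound hΨ hp0 hp1 (hK (Nat.find hex))
      have h1 : ((n : ℝ) + 2) / p ≤ (Nat.find hex : ℝ) :=
        (Nat.le_ceil _).trans (Nat.cast_le.2 (not_le.1 hL).le)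
      exact absurd ⟨_, by positivity, h' f A B hB hA hfB⟩ (Nat.find_min hex (hKL _ h1))
  have hcl : IsClosed s := by
    have : s = Set.Ici 0 ∩ ⋂ φ, {B | ‖f φ‖ ≤ B * orderSeminorm n 𝕜 L₀ φ} := by
      ext B
      simp [s]
    rw [this]
    exact isClosed_Ici.inter (isClosed_iInter fun φ =>
      isClosed_le continuous_const (continuous_id.mul continuous_const))
  have hbdd : BddBelow s := ⟨0, fun B hB => hB.1⟩
  obtain ⟨hB0, hB⟩ := hcl.csInf_mem hs hbdd
  set B := sInf s
  -- The infimum `B` is itself admissible, so improving it yields another admissible constant, which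
  -- cannot be smaller. This self-bound removes the dependence on `f`.
  have hle : B ≤ C * B ^ (1 - p) * A := by
    refine csInf_le hbdd ⟨by positivity, fun φ => (himp f A B hB0 hA hB φ).trans ?_⟩
    gcongr
    exact orderSeminorm_mono (hKL L₀ (Nat.le_ceil _)).le φ
  have hfin : B ≤ C ^ p⁻¹ * A ^ p⁻¹ := by
    -- The self-bound can be divided by `B^(1-p)` only when `B > 0`.
    rcases hB0.eq_or_lt with h0 | h0
    · rw [← h0]
      positivity
    · have h1 : B ^ p ≤ C * A := by
        have h2 : B ^ (1 - p) * B ^ p = B := by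
          rw [← Real.rpow_add h0, sub_add_cancel, Real.rpow_one]
        have h3 : 0 < B ^ (1 - p) := Real.rpow_pos_of_pos h0 _
        refine le_of_mul_le_mul_left ?_ h3
        rw [h2]
        linarith
      rw [← Real.mul_rpow hC hA0]
      exact (Real.le_rpow_inv_iff_of_pos hB0 (by positivity) hp0).2 h1
  exact fun φ => (hB φ).trans (by gcongr)

end APriori

/-! ### The extended-valued `p`-th power of the quasinorm, the metric and completeness. -/

section Mass

variable {n : ℕ} {𝕜 : Type*} [RCLike 𝕜]

/-- The integral of the `p`-th power of the maximal function over the cell. -/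
def hardyMass (Ψ : 𝓢(EuclideanSpace ℝ (Fin n), 𝕜)) (p : ℝ) (f : Distrib n 𝕜) : ENNReal :=
  ∫⁻ x, maximalFun Ψ f x ^ p ∂cellMeasure n

variable {Ψ : 𝓢(EuclideanSpace ℝ (Fin n), 𝕜)} {p : ℝ}

theorem mem_hardySpace_iff (hp0 : 0 < p) {f : Distrib n 𝕜} :
    f ∈ hardySpace Ψ p ↔ hardyMass Ψ p f < ⊤ := by
  have h1 : ENNReal.ofReal p ≠ 0 := by simpa using hp0
  have h2 := eLpNorm_lt_top_iff_lintegral_rpow_enorm_lt_top (f := maximalFun Ψ f)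
    (μ := cellMeasure n) h1 ENNReal.ofReal_ne_top
  rw [ENNReal.toReal_ofReal hp0.le] at h2
  simp only [enorm_eq_self] at h2
  exact ⟨fun h => h2.1 h.2, fun h => ⟨(measurable_maximalFun Ψ f).aestronglyMeasurable, h2.2 h⟩⟩

theorem hardyNorm_rpow (hp0 : 0 < p) (f : Distrib n 𝕜) :
    hardyNorm Ψ p f ^ p = (hardyMass Ψ p f).toReal := by
  have h1 : ENNReal.ofReal p ≠ 0 := by simpa using hp0
  rw [hardyNorm, eLpNorm_eq_lintegral_rpow_enorm_toReal h1 ENNReal.ofReal_ne_top,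
    ENNReal.toReal_ofReal hp0.le, ENNReal.toReal_rpow, ← ENNReal.rpow_mul, one_div,
    inv_mul_cancel₀ hp0.ne', ENNReal.rpow_one]
  simp only [enorm_eq_self]
  rfl

theorem conv_sub (f g : Distrib n 𝕜) (Ψ : 𝓢(EuclideanSpace ℝ (Fin n), 𝕜))
    (x : EuclideanSpace ℝ (Fin n)) : conv (f - g) Ψ x = conv f Ψ x - conv g Ψ x := rfl

theorem conv_neg (f : Distrib n 𝕜) (Ψ : 𝓢(EuclideanSpace ℝ (Fin n), 𝕜))
    (x : EuclideanSpace ℝ (Fin n)) : conv (-f) Ψ x = -conv f Ψ x := rfl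

theorem enorm_conv_le_maximalFun (f : Distrib n 𝕜) (ζ : Set.Ioi (0 : ℝ))
    (x : EuclideanSpace ℝ (Fin n)) : ‖conv f (dilate Ψ ζ) x‖ₑ ≤ maximalFun Ψ f x :=
  le_iSup (fun ζ => ‖conv f (dilate Ψ ζ) x‖ₑ) ζ

theorem maximalFun_sub_le (f g : Distrib n 𝕜) (x : EuclideanSpace ℝ (Fin n)) :
    maximalFun Ψ (f - g) x ≤ maximalFun Ψ f x + maximalFun Ψ g x := by
  refine iSup_le fun ζ => ?_
  rw [conv_sub]
  exact enorm_sub_le.trans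
    (add_le_add (enorm_conv_le_maximalFun f ζ x) (enorm_conv_le_maximalFun g ζ x))

theorem hardyMass_neg (f : Distrib n 𝕜) : hardyMass Ψ p (-f) = hardyMass Ψ p f := by
  simp only [hardyMass, maximalFun, conv_neg, enorm_neg]

theorem hardyMass_zero (hp0 : 0 < p) : hardyMass Ψ p (0 : Distrib n 𝕜) = 0 := by
  have h : ∀ ζ x, conv (0 : Distrib n 𝕜) (dilate Ψ ζ) x = 0 := fun _ _ => rfl
  simp [hardyMass, maximalFun, h, hp0]

theorem hardyMass_sub_le (hp0 : 0 < p) (hp1 : p ≤ 1) (f g : Distrib n 𝕜) :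
    hardyMass Ψ p (f - g) ≤ hardyMass Ψ p f + hardyMass Ψ p g := by
  rw [hardyMass, hardyMass, hardyMass,
    ← lintegral_add_left ((measurable_maximalFun Ψ f).pow_const p)]
  refine lintegral_mono fun x => ?_
  exact (ENNReal.rpow_le_rpow (maximalFun_sub_le f g x) hp0.le).trans
    (ENNReal.rpow_add_le_add_rpow _ _ hp0.le hp1)

theorem hardyMass_sub_comm (f g : Distrib n 𝕜) :
    hardyMass Ψ p (f - g) = hardyMass Ψ p (g - f) := by
  rw [← hardyMass_neg, neg_sub]

theorem hardyMass_sub_lt_top (hp0 : 0 < p) (hp1 : p ≤ 1) {f g : Distrib n 𝕜}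
    (hf : f ∈ hardySpace Ψ p) (hg : g ∈ hardySpace Ψ p) : hardyMass Ψ p (f - g) < ⊤ :=
  (hardyMass_sub_le hp0 hp1 f g).trans_lt (ENNReal.add_lt_top.2
    ⟨(mem_hardySpace_iff hp0).1 hf, (mem_hardySpace_iff hp0).1 hg⟩)

theorem hardyMass_triangle (hp0 : 0 < p) (hp1 : p ≤ 1) (f g h : Distrib n 𝕜) :
    hardyMass Ψ p (f - h) ≤ hardyMass Ψ p (f - g) + hardyMass Ψ p (g - h) := by
  rw [hardyMass_sub_comm g h, ← sub_sub_sub_cancel_right f h g]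
  exact hardyMass_sub_le hp0 hp1 _ _

theorem integral_norm_conv_rpow_le (hp0 : 0 < p) {f : Distrib n 𝕜} {A : ℝ} (hA : 0 ≤ A)
    (hf : hardyMass Ψ p f ≤ ENNReal.ofReal A) (ζ : Set.Ioi (0 : ℝ)) :
    ∫ x, ‖conv f (dilate Ψ ζ) x‖ ^ p ∂cellMeasure n ≤ A := by
  have hcont : Continuous fun x => ‖conv f (dilate Ψ ζ) x‖ ^ p :=
    (Real.continuous_rpow_const hp0.le).comp (continuous_conv f (dilate Ψ ζ)).norm
  rw [integral_eq_lintegral_of_nonneg_ae (ae_of_all _ fun x => by positivity)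
    hcont.aestronglyMeasurable]
  refine ENNReal.toReal_le_of_le_ofReal hA (le_trans (lintegral_mono fun x => ?_) hf)
  rw [← ENNReal.ofReal_rpow_of_nonneg (norm_nonneg _) hp0.le, ofReal_norm]
  exact ENNReal.rpow_le_rpow (enorm_conv_le_maximalFun f ζ x) hp0.le

/-- The Hardy space embeds continuously into the distributions of some fixed finite order. -/
theorem exists_norm_apply_le_hardyMass (hΨ : (∫ x, Ψ x) ≠ 0) (hp0 : 0 < p) (hp1 : p ≤ 1) :
    ∃ (L : ℕ) (C : ℝ), 0 ≤ C ∧ ∀ (f : Distrib n 𝕜) (A : ℝ), 0 ≤ A →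
      hardyMass Ψ p f ≤ ENNReal.ofReal A →
      ∀ φ, ‖f φ‖ ≤ C * A ^ p⁻¹ * orderSeminorm n 𝕜 L φ := by
  obtain ⟨L, C, hC, h⟩ := exists_norm_apply_le hΨ hp0 hp1
  exact ⟨L, C, hC, fun f A hA hf => h f A (integral_norm_conv_rpow_le hp0 hA hf)⟩

/-- The a priori estimate with `A = 0` annihilates every test function. -/
theorem eq_zero_of_hardyMass_eq_zero (hΨ : (∫ x, Ψ x) ≠ 0) (hp0 : 0 < p) (hp1 : p ≤ 1)
    {f : Distrib n 𝕜} (hf : hardyMass Ψ p f = 0) : f = 0 := by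
  obtain ⟨L, C, -, h⟩ := exists_norm_apply_le_hardyMass hΨ hp0 hp1
  refine ContinuousLinearMap.ext fun φ => norm_le_zero_iff.1 ?_
  have h1 := h f 0 le_rfl (by simp [hf]) φ
  rwa [Real.zero_rpow (inv_ne_zero hp0.ne'), mul_zero, zero_mul] at h1

theorem cauchySeq_apply (hΨ : (∫ x, Ψ x) ≠ 0) (hp0 : 0 < p) (hp1 : p ≤ 1)
    {u : ℕ → Distrib n 𝕜}
    (hc : ∀ ε > 0, ∃ N, ∀ j ≥ N, ∀ k ≥ N, hardyMass Ψ p (u j - u k) ≤ ENNReal.ofReal ε)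
    (φ : TestFun n 𝕜) : CauchySeq fun j => u j φ := by
  obtain ⟨L, C, hC, h⟩ := exists_norm_apply_le_hardyMass hΨ hp0 hp1
  rw [Metric.cauchySeq_iff]
  intro δ hδ
  have hφ : 0 ≤ orderSeminorm n 𝕜 L φ := apply_nonneg _ _
  -- The summand `1` keeps `c` positive and makes the final inequality strict. The tolerance `(δ /
  -- c)^p` cancels the exponent `p⁻¹` of the estimate.
  let c := C * orderSeminorm n 𝕜 L φ + 1
  have hc0 : 0 < c := by positivity
  obtain ⟨N, hN⟩ := hc ((δ / c) ^ p) (by positivity)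
  refine ⟨N, fun j hj k hk => ?_⟩
  have h1 := h (u j - u k) _ (by positivity) (hN j hj k hk) φ
  rw [Real.rpow_rpow_inv (by positivity) hp0.ne'] at h1
  rw [dist_eq_norm]
  refine h1.trans_lt ?_
  calc C * (δ / c) * orderSeminorm n 𝕜 L φ = (c - 1) * (δ / c) := by
        simp only [c]
        ring
    _ < c * (δ / c) := by
        have : 0 < δ / c := by positivity
        gcongr
        linarith
    _ = δ := by field_simp

theorem continuous_of_le_orderSeminorm {f : TestFun n 𝕜 →ₗ[𝕜] 𝕜} {L : ℕ} {B : ℝ} (hB : 0 ≤ B)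
    (h : ∀ φ, ‖f φ‖ ≤ B * orderSeminorm n 𝕜 L φ) : Continuous f :=
  (withSeminorms (n := n) (𝕜 := 𝕜)).continuous_normedSpace_rng 𝕜 f
    ⟨Finset.range (L + 1), ⟨B, hB⟩, h⟩

/-- The pointwise limit is linear. It is continuous because a Cauchy sequence has eventually bounded
mass, so the a priori estimate holds along the tail with one order and one constant and survives the
limit. -/
theorem exists_tendsto_apply (hΨ : (∫ x, Ψ x) ≠ 0) (hp0 : 0 < p) (hp1 : p ≤ 1)
    {u : ℕ → Distrib n 𝕜} (hu : ∀ j, u j ∈ hardySpace Ψ p)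
    (hc : ∀ ε > 0, ∃ N, ∀ j ≥ N, ∀ k ≥ N, hardyMass Ψ p (u j - u k) ≤ ENNReal.ofReal ε) :
    ∃ f : Distrib n 𝕜, ∀ φ, Tendsto (fun j => u j φ) atTop (𝓝 (f φ)) := by
  choose F hF using fun φ => cauchySeq_tendsto_of_complete (cauchySeq_apply hΨ hp0 hp1 hc φ)
  let f : TestFun n 𝕜 →ₗ[𝕜] 𝕜 :=
    linearMapOfTendsto F (fun j => (u j).toLinearMap) (tendsto_pi_nhds.2 hF)
  obtain ⟨L, C, hC, h⟩ := exists_norm_apply_le_hardyMass hΨ hp0 hp1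
  obtain ⟨N, hN⟩ := hc 1 one_pos
  have hfin : hardyMass Ψ p (u N) ≠ ⊤ := ((mem_hardySpace_iff hp0).1 (hu N)).ne
  let A := 1 + (hardyMass Ψ p (u N)).toReal
  have hA : 0 ≤ A := by positivity
  have hmass : ∀ j ≥ N, hardyMass Ψ p (u j) ≤ ENNReal.ofReal A := by
    intro j hj
    have h1 := hardyMass_triangle (Ψ := Ψ) hp0 hp1 (u j) (u N) 0
    rw [sub_zero, sub_zero] at h1
    rw [ENNReal.ofReal_add zero_le_one ENNReal.toReal_nonneg, ENNReal.ofReal_toReal hfin]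
    exact h1.trans (add_le_add_left (hN j hj N le_rfl) _)
  have hbound : ∀ φ, ‖f φ‖ ≤ C * A ^ p⁻¹ * orderSeminorm n 𝕜 L φ := fun φ =>
    le_of_tendsto (hF φ).norm
      ((eventually_ge_atTop N).mono fun j hj => h (u j) A hA (hmass j hj) φ)
  exact ⟨⟨f, continuous_of_le_orderSeminorm (by positivity) hbound⟩, hF⟩

/-- Lower semicontinuity of the Hardy mass under weak convergence. -/
theorem hardyMass_sub_le_of_tendsto (hp0 : 0 < p) {u : ℕ → Distrib n 𝕜} {f g : Distrib n 𝕜}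
    (hf : ∀ φ, Tendsto (fun k => u k φ) atTop (𝓝 (f φ))) {M : ENNReal}
    (hM : ∀ᶠ k in atTop, hardyMass Ψ p (g - u k) ≤ M) : hardyMass Ψ p (g - f) ≤ M := by
  calc hardyMass Ψ p (g - f)
      ≤ ∫⁻ x, liminf (fun k => maximalFun Ψ (g - u k) x ^ p) atTop ∂cellMeasure n := by
        refine lintegral_mono fun x => ?_
        -- The power is moved to the right so that the supremum over `ζ` can be tested one scale at
        -- a time. At a fixed scale and point, the convolution is the pairing with a fixed test
        -- function, hence converges.
        rw [← ENNReal.le_rpow_inv_iff hp0]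
        refine iSup_le fun ζ => ?_
        rw [ENNReal.le_rpow_inv_iff hp0]
        have h1 : Tendsto (fun k => ‖conv (g - u k) (dilate Ψ ζ) x‖ₑ ^ p) atTop
            (𝓝 (‖conv (g - f) (dilate Ψ ζ) x‖ₑ ^ p)) := by
          refine (ENNReal.continuous_rpow_const.tendsto _).comp ?_
          simp only [conv_sub]
          exact (tendsto_const_nhds.sub (hf _)).enorm
        rw [← h1.liminf_eq]
        exact liminf_le_liminf (Eventually.of_forall fun k =>
          ENNReal.rpow_le_rpow (enorm_conv_le_maximalFun _ ζ x) hp0.le)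
    _ ≤ liminf (fun k => hardyMass Ψ p (g - u k)) atTop :=
        lintegral_liminf_le fun k => (measurable_maximalFun Ψ _).pow_const p
    _ ≤ M := liminf_le_of_frequently_le' hM.frequently

theorem exists_hardyMass_limit (hΨ : (∫ x, Ψ x) ≠ 0) (hp0 : 0 < p) (hp1 : p ≤ 1)
    {u : ℕ → Distrib n 𝕜} (hu : ∀ j, u j ∈ hardySpace Ψ p)
    (hc : ∀ ε > 0, ∃ N, ∀ j ≥ N, ∀ k ≥ N, hardyMass Ψ p (u j - u k) ≤ ENNReal.ofReal ε) :
    ∃ f ∈ hardySpace Ψ p, ∀ ε > 0, ∃ N, ∀ j ≥ N,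
      hardyMass Ψ p (u j - f) ≤ ENNReal.ofReal ε := by
  obtain ⟨f, hf⟩ := exists_tendsto_apply hΨ hp0 hp1 hu hc
  have hlim : ∀ ε > 0, ∃ N, ∀ j ≥ N, hardyMass Ψ p (u j - f) ≤ ENNReal.ofReal ε := by
    intro ε hε
    obtain ⟨N, hN⟩ := hc ε hε
    exact ⟨N, fun j hj => hardyMass_sub_le_of_tendsto hp0 hf
      ((eventually_ge_atTop N).mono fun k hk => hN j hj k hk)⟩
  refine ⟨f, ?_, hlim⟩
  obtain ⟨N, hN⟩ := hlim 1 one_pos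
  -- The limit is a difference of two distributions of finite mass, `u N` and `u N - f`.
  rw [mem_hardySpace_iff hp0, ← sub_sub_cancel (u N) f]
  exact (hardyMass_sub_le hp0 hp1 _ _).trans_lt (ENNReal.add_lt_top.2
    ⟨(mem_hardySpace_iff hp0).1 (hu N), (hN N le_rfl).trans_lt ENNReal.ofReal_lt_top⟩)

/-- The metric `d(f, g) = ∫ (m_Ψ (f - g))^p` on the Hardy space. -/
abbrev hardyMetric (hΨ : (∫ x, Ψ x) ≠ 0) (hp0 : 0 < p) (hp1 : p ≤ 1) :
    MetricSpace (hardySpace Ψ p) where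
  dist f g := (hardyMass Ψ p (f.1 - g.1)).toReal
  dist_self f := by simp [hardyMass_zero hp0]
  dist_comm f g := by rw [hardyMass_sub_comm]
  dist_triangle f g h := by
    have hfg := (hardyMass_sub_lt_top hp0 hp1 f.2 g.2).ne
    have hgh := (hardyMass_sub_lt_top hp0 hp1 g.2 h.2).ne
    rw [← ENNReal.toReal_add hfg hgh]
    exact ENNReal.toReal_mono (ENNReal.add_ne_top.2 ⟨hfg, hgh⟩)
      (hardyMass_triangle hp0 hp1 _ _ _)
  eq_of_dist_eq_zero {f g} h := by
    have h1 := ((ENNReal.toReal_eq_zero_iff _).1 h).resolve_right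
      (hardyMass_sub_lt_top hp0 hp1 f.2 g.2).ne
    exact Subtype.ext (sub_eq_zero.1 (eq_zero_of_hardyMass_eq_zero hΨ hp0 hp1 h1))

theorem completeSpace_hardyMetric (hΨ : (∫ x, Ψ x) ≠ 0) (hp0 : 0 < p) (hp1 : p ≤ 1) :
    @CompleteSpace (hardySpace Ψ p) (hardyMetric hΨ hp0 hp1).toUniformSpace := by
  let _ := hardyMetric hΨ hp0 hp1
  have hdist : ∀ f g : hardySpace Ψ p, dist f g = (hardyMass Ψ p (f.1 - g.1)).toReal :=
    fun _ _ => rfl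
  refine Metric.complete_of_cauchySeq_tendsto fun u hu => ?_
  have hc : ∀ ε > 0, ∃ N, ∀ j ≥ N, ∀ k ≥ N,
      hardyMass Ψ p ((u j).1 - (u k).1) ≤ ENNReal.ofReal ε := by
    intro ε hε
    obtain ⟨N, hN⟩ := Metric.cauchySeq_iff.1 hu ε hε
    refine ⟨N, fun j hj k hk => ?_⟩
    rw [← ENNReal.ofReal_toReal (hardyMass_sub_lt_top hp0 hp1 (u j).2 (u k).2).ne]
    exact ENNReal.ofReal_le_ofReal (hN j hj k hk).le
  obtain ⟨f, hf, hlim⟩ := exists_hardyMass_limit hΨ hp0 hp1 (fun j => (u j).2) hc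
  refine ⟨⟨f, hf⟩, Metric.tendsto_atTop.2 fun ε hε => ?_⟩
  obtain ⟨N, hN⟩ := hlim (ε / 2) (half_pos hε)
  refine ⟨N, fun j hj => ?_⟩
  rw [hdist]
  exact (ENNReal.toReal_le_of_le_ofReal (half_pos hε).le (hN j hj)).trans_lt (half_lt_self hε)

end Mass

end TorusHardy
end

theorem propositionA4 {n : ℕ} (hn : 1 ≤ n) {𝕜 : Type*} [RCLike 𝕜]
    (Ψ : 𝓢(EuclideanSpace ℝ (Fin n), 𝕜)) (hΨ : (∫ x, Ψ x) ≠ 0)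
    (p : ℝ) (hp0 : 0 < p) (hp1 : p ≤ 1) :
    (∀ f ∈ TorusHardy.hardySpace Ψ p, ∀ g ∈ TorusHardy.hardySpace Ψ p,
      f - g ∈ TorusHardy.hardySpace Ψ p) ∧
    ∃ M : MetricSpace (TorusHardy.hardySpace Ψ p),
      (∀ f g : TorusHardy.hardySpace Ψ p,
        M.dist f g = TorusHardy.hardyNorm Ψ p (f.1 - g.1) ^ p) ∧
      @CompleteSpace (TorusHardy.hardySpace Ψ p) M.toUniformSpace :=
  ⟨fun _ hf _ hg => (TorusHardy.mem_hardySpace_iff hp0).2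
      (TorusHardy.hardyMass_sub_lt_top hp0 hp1 hf hg),
    TorusHardy.hardyMetric hΨ hp0 hp1, fun _ _ => (TorusHardy.hardyNorm_rpow hp0 _).symm,
    TorusHardy.completeSpace_hardyMetric hΨ hp0 hp1⟩
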